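/- Let $M$ be a connected smooth three-dimensional manifold, let $I\subset\mathbb R$ be a non-degenerate interval (for instance $I=[0,T)$; time derivatives at an endpoint in $I$ are one-sided), and let $$\gamma=-N^2\,dt^2+g_{ij}(t,x)\,dx^i dx^j,\qquad g_{ij}(t,x)=e^{2\sigma(t,x)}\bar g_{ij}(x),$$ be a Lorentzian metric on $I\times M$, where $N,\sigma$ are smooth functions on $I\times M$, $N>0$, $\partial_t\sigma\ge 0$, and $\bar g$ is a smooth Riemannian metric on $M$. Write $T=N^{-1}\partial_t$, let $D_T=N^{-1}\partial_t$ on functions, and let $h_{ij}=-\frac1{2N}\partial_t g_{ij}$ and $H=g^{ij}h_{ij}$ be the second fundamental form and the mean curvature of the slices $\{t\}\times M$. Suppose that $\gamma$ is a $k$-perfect fluid spacetime: the Einstein equation $R_{\alpha\beta}-\frac12R\,\gamma_{\alpha\beta}=\mathcal T_{\alpha\beta}$ holds with $\mathcal T_{TT}=\mu$, $\mathcal T_{Ti}=0$, $\mathcal T_{ij}=P g_{ij}$, where $P=(k-1)\mu$, for a mass density $\mu=\mu(t,x)$ and a parameter $k=k(t,x)\in[0,\frac43]$. Suppose moreover that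 $D_Tk=k'H$ for a function $k'$ with $$0\le k'\le\frac{k(9k^2-12k+8)}{3(4-3k)}$$ (the upper bound being void where $k=\frac43$). For example, $k$ may be constant in time. Let $\mathbf s=|W|_{\bar\gamma}/|\mathrm{Rm}|_{\bar\gamma}$ where the Riemann tensor $\mathrm{Rm}$ of $\gamma$ is non-zero and $\mathbf s=1$ where it is zero, where $W$ is the Weyl tensor of $\gamma$ and $\bar\gamma=N^2dt^2+g$. In local coordinates on $M$ let $\sqrt g=\sqrt{\det(g_{ij})}$, let $\mathcal S=\mathbf s\sqrt g$ be the Weyl entropy, and, for a function $\alpha$ with values in $[0,\frac13]$, let $$\mathcal S^{\mathbf{pf}}=\mathcal S+\mathbf{s_{crit}}\sqrt g,\qquad \mathbf{s_{crit}}=\sqrt{1-3\alpha}\left(\frac{\sqrt2}{4}+2k\sqrt{\frac{1-3\alpha}{9k^2-12k+8}}\right).$$ Then: 1. The slices are totally umbilic, $h_{ij}=\frac H3g_{ij}$, and $H=H(t)$ is constant on each slice. 2. The spacetime is purely electric, $W_{Tijk}=0$, and $\frac13$-expanding, that is, $h_{ij}\le\alpha Hg_{ij}\le0$ with $\alpha=\frac13$.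 Hence, with $\alpha=\frac13$, $\mathbf{s_{crit}}=0$ and $\mathcal S^{\mathbf{pf}}=\mathcal S$. 3. In every smooth local coordinate system on $M$ and at every point $x$ of its domain, $t\mapsto\mathcal S(t,x)$ is differentiable on $I$, $D_T\mathcal S\ge0$, and $\mathcal S(\cdot,x)$ is non-decreasing on $I$. -/

import Mathlib

open scoped Manifold ContDiff

noncomputable section

namespace WeylEntropy

/-- The model space `ℝ³` of the slices. -/
abbrev E3 : Type := EuclideanSpace ℝ (Fin 3)

/-- Spacetime indices: `Sum.inl ()` is the time index, `Sum.inr i` the `i`-th space index. -/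
abbrev Idx : Type := Unit ⊕ Fin 3

/-! ### Curvature of a metric given by its components in coordinates `(t, y) ∈ I × ℝ³`

`γ t y` is the matrix of the components of the metric at `(t, y)`. Time derivatives are taken
within the time interval `I`, so that they are one-sided at an endpoint belonging to `I`. -/

section Coordinates

variable (I : Set ℝ)

/-- The partial derivative `∂_α f` of a function `f(t, y)`. -/
def pd (α : Idx) (f : ℝ → E3 → ℝ) (t : ℝ) (y : E3) : ℝ :=
  match α with
  | Sum.inl _ => derivWithin (fun s => f s y) I t
  | Sum.inr i => fderiv ℝ (f t) y (EuclideanSpace.single i 1)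

variable (γ : ℝ → E3 → Matrix Idx Idx ℝ)

/-- Christoffel symbols `Γ^ρ_{μν}` of the Levi-Civita connection. -/
def christoffel (ρ μ ν : Idx) (t : ℝ) (y : E3) : ℝ :=
  (1 / 2) * ∑ l, (γ t y)⁻¹ ρ l *
    (pd I μ (fun s z => γ s z ν l) t y + pd I ν (fun s z => γ s z μ l) t y
      - pd I l (fun s z => γ s z μ ν) t y)

/-- `R^ρ_{σμν} = ∂_μ Γ^ρ_{νσ} - ∂_ν Γ^ρ_{μσ} + Γ^ρ_{μl} Γ^l_{νσ} - Γ^ρ_{νl} Γ^l_{μσ}`. -/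
def riemannUp (ρ σ μ ν : Idx) (t : ℝ) (y : E3) : ℝ :=
  pd I μ (christoffel I γ ρ ν σ) t y - pd I ν (christoffel I γ ρ μ σ) t y
    + ∑ l, (christoffel I γ ρ μ l t y * christoffel I γ l ν σ t y
      - christoffel I γ ρ ν l t y * christoffel I γ l μ σ t y)

/-- The Riemann tensor `R_{αβγδ}`, all indices lowered. -/
def riemann (a b c d : Idx) (t : ℝ) (y : E3) : ℝ :=
  ∑ ρ, γ t y a ρ * riemannUp I γ ρ b c d t y

/-- The Ricci tensor `R_{βδ} = γ^{αγ} R_{αβγδ}` (positive on round spheres). -/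
def ricci (b d : Idx) (t : ℝ) (y : E3) : ℝ :=
  ∑ a, ∑ c, (γ t y)⁻¹ a c * riemann I γ a b c d t y

/-- The scalar curvature. -/
def scalar (t : ℝ) (y : E3) : ℝ :=
  ∑ a, ∑ b, (γ t y)⁻¹ a b * ricci I γ a b t y

/-- The Weyl tensor `W_{αβγδ}` in dimension four. -/
def weyl (a b c d : Idx) (t : ℝ) (y : E3) : ℝ :=
  riemann I γ a b c d t y
    - (1 / 2) * (ricci I γ a c t y * γ t y b d - ricci I γ a d t y * γ t y b c
      + ricci I γ b d t y * γ t y a c - ricci I γ b c t y * γ t y a d)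
    + scalar I γ t y / 6 * (γ t y a c * γ t y b d - γ t y a d * γ t y b c)

/-- The Einstein tensor `R_{αβ} - (1/2) R γ_{αβ}`. -/
def einstein (a b : Idx) (t : ℝ) (y : E3) : ℝ :=
  ricci I γ a b t y - (1 / 2) * scalar I γ t y * γ t y a b

end Coordinates

/-- The norm `|P|_q` of a `(0,4)`-tensor `P` with respect to a Riemannian inner product `q`. -/
def norm4 (q : Matrix Idx Idx ℝ) (P : Idx → Idx → Idx → Idx → ℝ) : ℝ :=
  Real.sqrt (∑ a, ∑ b, ∑ c, ∑ d, ∑ a', ∑ b', ∑ c', ∑ d',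
    q⁻¹ a a' * q⁻¹ b b' * q⁻¹ c c' * q⁻¹ d d' * P a b c d * P a' b' c' d')

/-! ### Foliated spacetimes `(I × M, -N² dt² + g)` -/

section Spacetime

variable {M : Type*} [TopologicalSpace M] [ChartedSpace E3 M]

/-- A time-dependent field of bilinear forms on the tangent spaces of `M`. -/
abbrev BilinField (M : Type*) [TopologicalSpace M] [ChartedSpace E3 M] : Type _ :=
  ℝ → (x : M) → TangentSpace (𝓡 3) x →L[ℝ] TangentSpace (𝓡 3) x →L[ℝ] ℝ

/-- The coordinate vector field `∂_i` of the chart `e`, at the point with coordinates `y`. -/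
def coordVec (e : OpenPartialHomeomorph M E3) (i : Fin 3) (y : E3) :
    TangentSpace (𝓡 3) (e.symm y) :=
  mfderiv (𝓡 3) (𝓡 3) e.symm y (EuclideanSpace.single i (1 : ℝ) : E3)

/-- The components `g_{ij}(t, y)` in the chart `e`. -/
def spaceComp (g : BilinField M) (e : OpenPartialHomeomorph M E3) (t : ℝ) (y : E3) :
    Matrix (Fin 3) (Fin 3) ℝ :=
  Matrix.of fun i j => g t (e.symm y) (coordVec e i y) (coordVec e j y)

/-- The components of the Lorentzian metric `γ = -N² dt² + g`. -/
def lorentz (N : ℝ → M → ℝ) (g : BilinField M) (e : OpenPartialHomeomorph M E3)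
    (t : ℝ) (y : E3) : Matrix Idx Idx ℝ :=
  Matrix.fromBlocks (Matrix.of fun _ _ => -(N t (e.symm y)) ^ 2) 0 0 (spaceComp g e t y)

/-- The components of the associated Riemannian metric `N² dt² + g`. -/
def riemMetric (N : ℝ → M → ℝ) (g : BilinField M) (e : OpenPartialHomeomorph M E3)
    (t : ℝ) (y : E3) : Matrix Idx Idx ℝ :=
  Matrix.fromBlocks (Matrix.of fun _ _ => (N t (e.symm y)) ^ 2) 0 0 (spaceComp g e t y)

/-- The second fundamental form `h = -(1/(2N)) ∂_t g` of the slice `{t} × M`. -/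
def secondForm (I : Set ℝ) (N : ℝ → M → ℝ) (g : BilinField M) (t : ℝ) (x : M)
    (v w : TangentSpace (𝓡 3) x) : ℝ :=
  -(1 / (2 * N t x)) * derivWithin (fun s => g s x v w) I t

/-- The basis of `T_x M` that the model space provides. -/
def tangentBasis (x : M) (i : Fin 3) : TangentSpace (𝓡 3) x :=
  (EuclideanSpace.single i (1 : ℝ) : E3)

/-- The mean curvature `H = g^{ij} h_{ij}`. The trace does not depend on the basis of `T_x M`. -/
def meanCurv (I : Set ℝ) (N : ℝ → M → ℝ) (g : BilinField M) (t : ℝ) (x : M) : ℝ :=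
  ∑ i, ∑ j,
    (Matrix.of fun k l => g t x (tangentBasis x k) (tangentBasis x l) :
      Matrix (Fin 3) (Fin 3) ℝ)⁻¹ i j
      * secondForm I N g t x (tangentBasis x i) (tangentBasis x j)

/-- The slices are umbilic: `h = (H/3) g`. -/
def IsUmbilic (I : Set ℝ) (N : ℝ → M → ℝ) (g : BilinField M) : Prop :=
  ∀ t ∈ I, ∀ (x : M) (v w : TangentSpace (𝓡 3) x),
    secondForm I N g t x v w = meanCurv I N g t x / 3 * g t x v w

/-- The spacetime is `α`-expanding: `0 ≤ α ≤ 1/3` and `h ≤ α H g ≤ 0` as quadratic forms. -/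
def IsExpanding (I : Set ℝ) (N : ℝ → M → ℝ) (g : BilinField M) (α : ℝ → M → ℝ) : Prop :=
  ∀ t ∈ I, ∀ x : M, α t x ∈ Set.Icc (0 : ℝ) (1 / 3) ∧
    ∀ v : TangentSpace (𝓡 3) x,
      secondForm I N g t x v v ≤ α t x * meanCurv I N g t x * g t x v v ∧
      α t x * meanCurv I N g t x * g t x v v ≤ 0

/-- The stress-energy tensor of a perfect fluid with mass density `μ` and pressure `P`, that is,
`𝒯_{TT} = μ`, `𝒯_{Ti} = 0`, `𝒯_{ij} = P g_{ij}` where `T = N⁻¹ ∂_t`; hence `𝒯_{00} = N² μ`. -/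
def fluidTensor (N : ℝ → M → ℝ) (g : BilinField M) (μ P : ℝ → M → ℝ)
    (e : OpenPartialHomeomorph M E3) (t : ℝ) (y : E3) : Matrix Idx Idx ℝ :=
  Matrix.fromBlocks (Matrix.of fun _ _ => (N t (e.symm y)) ^ 2 * μ t (e.symm y)) 0 0
    (P t (e.symm y) • spaceComp g e t y)

/-- The Einstein equation holds with the stress-energy tensor of a `k`-perfect fluid of mass
density `μ`: the pressure is `P = (k - 1) μ`, and `k` takes values in `[0, 4/3]`. -/
def IsPerfectFluid (I : Set ℝ) (N : ℝ → M → ℝ) (g : BilinField M) (μ k : ℝ → M → ℝ) : Prop :=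
  (∀ t ∈ I, ∀ x : M, k t x ∈ Set.Icc (0 : ℝ) (4 / 3)) ∧
  ∀ e ∈ IsManifold.maximalAtlas (𝓡 3) ∞ M, ∀ t ∈ I, ∀ y ∈ e.target, ∀ a b : Idx,
    einstein I (lorentz N g e) a b t y
      = fluidTensor N g μ (fun s x => (k s x - 1) * μ s x) e t y a b

/-- The evolution condition on the parameter `k`: there is a function `k'` with
`D_T k = N⁻¹ ∂_t k = k' H` and `0 ≤ k' ≤ k (9k² - 12k + 8) / (3 (4 - 3k))`, the upper bound being
no condition where `k = 4/3`. -/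
def FluidEvolution (I : Set ℝ) (N : ℝ → M → ℝ) (g : BilinField M) (k : ℝ → M → ℝ) : Prop :=
  ∃ k' : ℝ → M → ℝ, ∀ t ∈ I, ∀ x : M,
    HasDerivWithinAt (fun s => k s x) (N t x * (k' t x * meanCurv I N g t x)) I t ∧
    0 ≤ k' t x ∧
    k' t x * (3 * (4 - 3 * k t x)) ≤ k t x * (9 * k t x ^ 2 - 12 * k t x + 8)

/-- The spacetime is purely electric: `W_{Tijk} = 0`, equivalently `W_{0ijk} = 0`. -/
def IsPurelyElectric (I : Set ℝ) (N : ℝ → M → ℝ) (g : BilinField M) : Prop :=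
  ∀ e ∈ IsManifold.maximalAtlas (𝓡 3) ∞ M, ∀ t ∈ I, ∀ y ∈ e.target, ∀ i j l : Fin 3,
    weyl I (lorentz N g e) (Sum.inl ()) (Sum.inr i) (Sum.inr j) (Sum.inr l) t y = 0

/-- `√g`, the square root of the determinant of `(g_{ij})` in the chart `e`. -/
def sqrtDet (g : BilinField M) (e : OpenPartialHomeomorph M E3) (t : ℝ) (y : E3) : ℝ :=
  Real.sqrt (spaceComp g e t y).det

open Classical in
/-- The Weyl entropy density `s`: `|W| / |R|` (norms with respect to `N² dt² + g`) where the
Riemann tensor does not vanish, and `1` where it does. -/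
def weylDensity (I : Set ℝ) (N : ℝ → M → ℝ) (g : BilinField M)
    (e : OpenPartialHomeomorph M E3) (t : ℝ) (y : E3) : ℝ :=
  if ∀ a b c d : Idx, riemann I (lorentz N g e) a b c d t y = 0 then 1
  else
    norm4 (riemMetric N g e t y) (fun a b c d => weyl I (lorentz N g e) a b c d t y) /
      norm4 (riemMetric N g e t y) (fun a b c d => riemann I (lorentz N g e) a b c d t y)

/-- The Weyl entropy `S = s √g` in the coordinates of the chart `e`. -/
def weylEntropy (I : Set ℝ) (N : ℝ → M → ℝ) (g : BilinField M)
    (e : OpenPartialHomeomorph M E3) (t : ℝ) (y : E3) : ℝ :=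
  weylDensity I N g e t y * sqrtDet g e t y

/-- The critical density `s_crit` as a function of the parameters `k` and `α`. -/
def sCrit (k α : ℝ) : ℝ :=
  Real.sqrt (1 - 3 * α) *
    (Real.sqrt 2 / 4 + 2 * k * Real.sqrt ((1 - 3 * α) / (9 * k ^ 2 - 12 * k + 8)))

/-- The modified Weyl entropy `S^pf = S + s_crit √g` in the coordinates of the chart `e`. -/
def fluidEntropy (I : Set ℝ) (N : ℝ → M → ℝ) (g : BilinField M) (k α : ℝ → M → ℝ)
    (e : OpenPartialHomeomorph M E3) (t : ℝ) (y : E3) : ℝ :=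
  weylEntropy I N g e t y + sCrit (k t (e.symm y)) (α t (e.symm y)) * sqrtDet g e t y

end Spacetime

end WeylEntropy

end

/-! Write θ = σ_t / N, so that ∂_t g = 2Nθ g. Then h = -θ g and H = -3θ: umbilicity and the
1/3-expanding property are immediate, the latter with equality in h ≤ (H/3) g. The traced Codazzi
equation is 𝒯_{Tj} = 0, which forces ∂_j θ = 0 (`IsFluid.deriv_θ`). Connectedness makes H constant
on the slices, and the Codazzi equation then kills the mixed curvature R_{Tijk}, hence W_{Tijk}.

For the entropy, let E be the electric part of the Weyl tensor. Isotropic stress makes the spatial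
part of the spacetime Ricci tensor pure trace. So E is the trace-free intrinsic Ricci tensor of the
slice, and N E is also the trace-free Hessian of the lapse (`IsFluid.tf_eq`, `IsFluid.hess_eq`). The
first variation of the Ricci tensor under a conformal change gives ∂_t Ric_tf = -θ (Hess N)_tf, that
is, ∂_t E = -σ_t E (`IsFluid.hasDerivWithinAt_tf`). Thus e^σ E is constant in time and |E|² = c
e^{-6σ}. Since |W|² = 8|E|² and √g is proportional to e^{3σ}, the product |W| √g does not depend on
time.

Where Rm ≠ 0 the entropy is therefore a constant divided by |Rm|, and |Rm| has to be non-increasing.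
Here |Rm|² = 8|E|² + μ²(9k² - 12k + 8)/3, with ∂_t μ = -3σ_t k μ (`IsFluid.hasDerivWithinAt_μ`) and
∂_t k = -3σ_t k'. The bound on k' is what makes the derivative non-positive
(`FluidLine.curvSq_rate_nonneg`). If Rm vanishes at one time it vanishes at all times at that point
of M, and the entropy is √g, which grows with σ.

The curvature identities are proved over a commutative ring with commuting derivations, where they
become polynomial algebra. The ring is then taken to be the smooth functions on I × U, with
one-sided derivatives at the endpoints of I. -/

noncomputable section

namespace WeylEntropy

/-! ### Curvature in a differential ring -/

section DifferentialRing

variable {ι A : Type*} [Fintype ι] [CommRing A] [Algebra ℝ A]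
  (D : ι → Derivation ℝ A A) (γ γi : Matrix ι ι A)

/-- Christoffel symbols of a metric `γ` with inverse `γi` over a differential ring. -/
def chr (ρ μ ν : ι) : A :=
  algebraMap ℝ A (1 / 2) *
    ∑ l, γi ρ l * (D μ (γ ν l) + D ν (γ μ l) - D l (γ μ ν))

/-- Christoffel symbols with the first index lowered. -/
def chrLow (ρ μ ν : ι) : A := ∑ m, γ ρ m * chr D γ γi m μ ν

/-- The curvature tensor `R^ρ_{σμν}` over a differential ring. -/
def riemUp (ρ σ μ ν : ι) : A :=
  D μ (chr D γ γi ρ ν σ) - D ν (chr D γ γi ρ μ σ)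
    + ∑ l, (chr D γ γi ρ μ l * chr D γ γi l ν σ - chr D γ γi ρ ν l * chr D γ γi l μ σ)

/-- The curvature tensor with all indices lowered. -/
def riemLow (a b c d : ι) : A := ∑ ρ, γ a ρ * riemUp D γ γi ρ b c d

variable {D γ γi}

lemma two_mul_half (a : A) : 2 * (algebraMap ℝ A (1 / 2) * a) = a := by
  rw [← mul_assoc, show (2 : A) = algebraMap ℝ A 2 from (map_ofNat _ 2).symm, ← map_mul]
  norm_num

/-- The factor 1/2 in the Christoffel symbols comes from the ℝ-algebra structure; identities are
doubled to clear it. -/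
lemma eq_of_two_mul_eq {a b : A} (h : 2 * a = 2 * b) : a = b := by
  have := congrArg (fun x => algebraMap ℝ A (1 / 2) * x) h
  rwa [mul_left_comm, two_mul_half, mul_left_comm, two_mul_half] at this

lemma chr_comm (hs : γ.IsSymm) (ρ μ ν : ι) : chr D γ γi ρ μ ν = chr D γ γi ρ ν μ := by
  unfold chr
  congr 1
  refine Finset.sum_congr rfl fun l _ => ?_
  rw [hs.apply μ ν]
  ring

/-- Koszul formula. Lowering the index cancels the inverse metric, so lowered symbols are linear in
the derivatives of the metric. -/
lemma two_chrLow [DecidableEq ι] (hi : γ * γi = 1) (ρ μ ν : ι) :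
    2 * chrLow D γ γi ρ μ ν = D μ (γ ν ρ) + D ν (γ μ ρ) - D ρ (γ μ ν) := by
  have h : chrLow D γ γi ρ μ ν = algebraMap ℝ A (1 / 2) *
      ∑ l, (γ * γi) ρ l * (D μ (γ ν l) + D ν (γ μ l) - D l (γ μ ν)) := by
    simp only [chrLow, chr, Matrix.mul_apply, Finset.mul_sum, Finset.sum_mul]
    rw [Finset.sum_comm]
    refine Finset.sum_congr rfl fun l _ => Finset.sum_congr rfl fun m _ => ?_
    ring
  rw [h, two_mul_half, hi]
  simp [Matrix.one_apply]

lemma chrLow_comm (hs : γ.IsSymm) (ρ μ ν : ι) :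
    chrLow D γ γi ρ μ ν = chrLow D γ γi ρ ν μ := by
  simp only [chrLow, chr_comm hs _ μ ν]

/-- Metric compatibility of the connection, as the sum of two Koszul formulas. -/
lemma deriv_metric [DecidableEq ι] (hs : γ.IsSymm) (hi : γ * γi = 1) (μ ρ ν : ι) :
    D μ (γ ρ ν) = chrLow D γ γi ρ μ ν + chrLow D γ γi ν μ ρ := by
  apply eq_of_two_mul_eq
  rw [mul_add, two_chrLow hi, two_chrLow hi, hs.apply ρ ν]
  ring

/-- The index is moved inside the derivative: γ ∂Γ = ∂(γΓ) - (∂γ)Γ. By metric compatibility ∂γ is a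
sum of two lowered symbols, one of which cancels the quadratic term of the curvature. Only lowered
symbols remain to be differentiated. -/
lemma riemLow_eq [DecidableEq ι] (hs : γ.IsSymm) (hi : γ * γi = 1) (a b c d : ι) :
    riemLow D γ γi a b c d = D c (chrLow D γ γi a d b) - D d (chrLow D γ γi a c b)
      - ∑ ρ, (chrLow D γ γi ρ c a * chr D γ γi ρ d b
          - chrLow D γ γi ρ d a * chr D γ γi ρ c b) := by
  have h1 : ∀ c d : ι, D c (chrLow D γ γi a d b) = ∑ ρ, γ a ρ * D c (chr D γ γi ρ d b)
      + ∑ ρ, (chrLow D γ γi a c ρ + chrLow D γ γi ρ c a) * chr D γ γi ρ d b := by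
    intro c d
    simp only [← deriv_metric hs hi, ← Finset.sum_add_distrib]
    conv_lhs => rw [chrLow]
    simp only [map_sum, Derivation.leibniz, smul_eq_mul]
    exact Finset.sum_congr rfl fun m _ => by ring
  have h2 : ∀ c d : ι, ∑ ρ, γ a ρ * ∑ l, chr D γ γi ρ c l * chr D γ γi l d b
      = ∑ ρ, chrLow D γ γi a c ρ * chr D γ γi ρ d b := by
    intro c d
    simp only [chrLow, Finset.mul_sum, Finset.sum_mul]
    rw [Finset.sum_comm]
    exact Finset.sum_congr rfl fun l _ => Finset.sum_congr rfl fun m _ => by ring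
  simp only [riemLow, riemUp, mul_add, mul_sub, Finset.sum_add_distrib, Finset.sum_sub_distrib,
    h2, h1, add_mul]
  ring

lemma chrLow_mul_chr_comm (hs : γ.IsSymm) (a b c d : ι) :
    ∑ ρ, chrLow D γ γi ρ a b * chr D γ γi ρ c d
      = ∑ ρ, chrLow D γ γi ρ c d * chr D γ γi ρ a b := by
  simp only [chrLow, Finset.sum_mul]
  rw [Finset.sum_comm]
  refine Finset.sum_congr rfl fun l _ => Finset.sum_congr rfl fun m _ => ?_
  rw [hs.apply l m]
  ring

/-- Expand [∂_c, ∂_d] γ_{ab} = 0 by metric compatibility. -/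
lemma riemLow_antisymm_left [DecidableEq ι] (hD : ∀ a b x, D a (D b x) = D b (D a x))
    (hs : γ.IsSymm) (hi : γ * γi = 1) (a b c d : ι) :
    riemLow D γ γi a b c d = -riemLow D γ γi b a c d := by
  have h := hD c d (γ a b)
  rw [deriv_metric hs hi, deriv_metric hs hi, map_add, map_add] at h
  have h1 := chrLow_mul_chr_comm (D := D) (γi := γi) hs c a d b
  have h2 := chrLow_mul_chr_comm (D := D) (γi := γi) hs d a c b
  rw [riemLow_eq hs hi, riemLow_eq hs hi, Finset.sum_sub_distrib, Finset.sum_sub_distrib]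
  linear_combination h - h1 + h2

lemma riemLow_antisymm_right (a b c d : ι) :
    riemLow D γ γi a b c d = -riemLow D γ γi a b d c := by
  simp only [riemLow, riemUp, ← Finset.sum_neg_distrib]
  refine Finset.sum_congr rfl fun ρ _ => ?_
  rw [Finset.sum_sub_distrib, Finset.sum_sub_distrib]
  ring

end DifferentialRing

/-- A metric `-N² dt² + g` with umbilic slices, `∂_t g = 2 N θ g`, over a differential ring. -/
structure UmbilicData (A : Type*) [CommRing A] [Algebra ℝ A] where
  D : Idx → Derivation ℝ A A
  comm : ∀ a b x, D a (D b x) = D b (D a x)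
  g : Matrix (Fin 3) (Fin 3) A
  gi : Matrix (Fin 3) (Fin 3) A
  symm : g.IsSymm
  inv : g * gi = 1
  N : A
  Ni : A
  N_inv : N * Ni = 1
  -- θ is -H/3. Its constancy on the slices is not part of the data; it enters below as the
  -- hypothesis `hθ`.
  θ : A
  dt_g : ∀ i j, D (Sum.inl ()) (g i j) = 2 * (N * θ) * g i j

/-! ### Gauss, Codazzi and lapse equations for umbilic slices -/

namespace UmbilicData

open scoped Matrix

variable {A : Type*} [CommRing A] [Algebra ℝ A] (X : UmbilicData A)

/-- The spacetime metric. -/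
def met : Matrix Idx Idx A := Matrix.fromBlocks (Matrix.of fun _ _ => -X.N ^ 2) 0 0 X.g

/-- The inverse of the spacetime metric. -/
def metInv : Matrix Idx Idx A := Matrix.fromBlocks (Matrix.of fun _ _ => -X.Ni ^ 2) 0 0 X.gi

/-- The time derivation. -/
abbrev D₀ : Derivation ℝ A A := X.D (Sum.inl ())

/-- The spatial derivations. -/
abbrev D₃ (i : Fin 3) : Derivation ℝ A A := X.D (Sum.inr i)

/-- Christoffel symbols of the slices. -/
abbrev Γ (k i j : Fin 3) : A := chr X.D₃ X.g X.gi k i j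

/-- Christoffel symbols of the slices, lowered. -/
abbrev L (k i j : Fin 3) : A := chrLow X.D₃ X.g X.gi k i j

/-- The curvature tensor of the slices. -/
abbrev K (k l i j : Fin 3) : A := riemLow X.D₃ X.g X.gi k l i j

/-- The curvature tensor of the spacetime. -/
abbrev R (a b c d : Idx) : A := riemLow X.D X.met X.metInv a b c d

/-- The Hessian of the lapse on the slices. -/
def hess (l j : Fin 3) : A := X.D₃ j (X.D₃ l X.N) - ∑ m, X.Γ m j l * X.D₃ m X.N

lemma met_symm : X.met.IsSymm := by
  rw [met, Matrix.isSymm_fromBlocks_iff]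
  exact ⟨by ext; simp, by simp, by simp, X.symm⟩

lemma N_mul_inv_sq : X.N ^ 2 * X.Ni ^ 2 = 1 := by
  rw [← mul_pow, X.N_inv, one_pow]

lemma met_inv : X.met * X.metInv = 1 := by
  rw [met, metInv, Matrix.fromBlocks_multiply, X.inv]
  simp only [Matrix.mul_zero, Matrix.zero_mul, add_zero, zero_add]
  rw [← Matrix.fromBlocks_one]
  congr 1
  ext i j
  simp [Matrix.mul_apply, X.N_mul_inv_sq]

lemma inv' : X.gi * X.g = 1 := mul_eq_one_comm.mp X.inv

lemma gi_symm : X.gi.IsSymm := by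
  have h := congrArg Matrix.transpose X.inv
  rw [Matrix.transpose_mul, X.symm.eq, Matrix.transpose_one] at h
  calc X.giᵀ = X.giᵀ * (X.g * X.gi) := by rw [X.inv, mul_one]
    _ = X.gi := by rw [← mul_assoc, h, one_mul]

lemma sum_gi_mul_g (k j : Fin 3) : ∑ l, X.gi k l * X.g l j = if k = j then 1 else 0 := by
  rw [← Matrix.mul_apply, X.inv', Matrix.one_apply]

lemma chr_sss (k i j : Fin 3) :
    chr X.D X.met X.metInv (Sum.inr k) (Sum.inr i) (Sum.inr j) = X.Γ k i j := by
  simp [chr, met, metInv]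

lemma chr_tss (i j : Fin 3) :
    chr X.D X.met X.metInv (Sum.inl ()) (Sum.inr i) (Sum.inr j) = X.θ * X.Ni * X.g i j := by
  apply eq_of_two_mul_eq
  rw [chr, two_mul_half]
  simp [met, metInv, X.dt_g]
  linear_combination 2 * X.θ * X.Ni * X.g i j * X.N_inv

lemma chr_sts (k j : Fin 3) :
    chr X.D X.met X.metInv (Sum.inr k) (Sum.inl ()) (Sum.inr j)
      = if k = j then X.N * X.θ else 0 := by
  apply eq_of_two_mul_eq
  rw [chr, two_mul_half]
  simp only [met, metInv, Fintype.sum_sum_type, Matrix.fromBlocks_apply₂₁,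
    Matrix.fromBlocks_apply₂₂, Matrix.fromBlocks_apply₁₂, Matrix.zero_apply, map_zero, zero_mul,
    Finset.sum_const_zero, zero_add, X.dt_g, add_zero, sub_zero]
  have : ∀ l, X.gi k l * (2 * (X.N * X.θ) * X.g j l)
      = 2 * (X.N * X.θ) * (X.gi k l * X.g l j) := fun l => by
    rw [X.symm.apply l j]; ring
  simp only [this, ← Finset.mul_sum, X.sum_gi_mul_g]
  split_ifs <;> ring

lemma chr_tts (j : Fin 3) :
    chr X.D X.met X.metInv (Sum.inl ()) (Sum.inl ()) (Sum.inr j) = X.Ni * X.D₃ j X.N := by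
  apply eq_of_two_mul_eq
  rw [chr, two_mul_half]
  simp [met, metInv, pow_two]
  linear_combination 2 * X.Ni * X.D₃ j X.N * X.N_inv

lemma chrLow_sss (k i j : Fin 3) :
    chrLow X.D X.met X.metInv (Sum.inr k) (Sum.inr i) (Sum.inr j) = X.L k i j := by
  simp only [chrLow, Fintype.sum_sum_type, chr_sss]
  simp [met]

lemma chrLow_tss (i j : Fin 3) :
    chrLow X.D X.met X.metInv (Sum.inl ()) (Sum.inr i) (Sum.inr j)
      = -(X.N * X.θ * X.g i j) := by
  apply eq_of_two_mul_eq
  rw [two_chrLow X.met_inv]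
  simp [met, X.dt_g]
  ring

lemma chrLow_sts (k j : Fin 3) :
    chrLow X.D X.met X.metInv (Sum.inr k) (Sum.inl ()) (Sum.inr j) = X.N * X.θ * X.g k j := by
  apply eq_of_two_mul_eq
  rw [two_chrLow X.met_inv]
  simp [met, X.dt_g, X.symm.apply k j]
  ring

lemma chrLow_tts (j : Fin 3) :
    chrLow X.D X.met X.metInv (Sum.inl ()) (Sum.inl ()) (Sum.inr j) = -(X.N * X.D₃ j X.N) := by
  apply eq_of_two_mul_eq
  rw [two_chrLow X.met_inv]
  simp [met, pow_two]
  ring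

lemma chrLow_stt (k : Fin 3) :
    chrLow X.D X.met X.metInv (Sum.inr k) (Sum.inl ()) (Sum.inl ()) = X.N * X.D₃ k X.N := by
  apply eq_of_two_mul_eq
  rw [two_chrLow X.met_inv]
  simp [met, pow_two]
  ring

lemma chrLow_ttt :
    chrLow X.D X.met X.metInv (Sum.inl ()) (Sum.inl ()) (Sum.inl ()) = -(X.N * X.D₀ X.N) := by
  apply eq_of_two_mul_eq
  rw [two_chrLow X.met_inv]
  simp [met, pow_two]
  ring

lemma chrLow_tst (j : Fin 3) :
    chrLow X.D X.met X.metInv (Sum.inl ()) (Sum.inr j) (Sum.inl ()) = -(X.N * X.D₃ j X.N) := by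
  rw [chrLow_comm X.met_symm, chrLow_tts]

lemma chrLow_sst (k j : Fin 3) :
    chrLow X.D X.met X.metInv (Sum.inr k) (Sum.inr j) (Sum.inl ()) = X.N * X.θ * X.g k j := by
  rw [chrLow_comm X.met_symm, chrLow_sts]

lemma D_g (i j k : Fin 3) : X.D₃ i (X.g j k) = X.L j i k + X.L k i j :=
  deriv_metric X.symm X.inv i j k

lemma L_comm (k i j : Fin 3) : X.L k i j = X.L k j i := chrLow_comm X.symm k i j

lemma sum_g_mul_Γ (k i j : Fin 3) : ∑ m, X.g m k * X.Γ m i j = X.L k i j := by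
  simp only [chrLow, X.symm.apply k]

/-- Codazzi equation. -/
lemma R_tsss (l i j : Fin 3) : X.R (Sum.inl ()) (Sum.inr l) (Sum.inr i) (Sum.inr j)
    = X.N * (X.D₃ j X.θ * X.g i l - X.D₃ i X.θ * X.g j l) := by
  rw [R, riemLow_eq X.met_symm X.met_inv]
  simp only [chrLow_tss, Fintype.sum_sum_type, chrLow_tst, chrLow_sst, chr_tss, chr_sss,
    Finset.univ_unique, Finset.sum_singleton, map_neg, Derivation.leibniz, smul_eq_mul, D_g,
    Finset.sum_sub_distrib, mul_assoc, ← Finset.mul_sum, PUnit.default_eq_unit, sum_g_mul_Γ]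
  rw [X.L_comm i j l, X.L_comm j i l, X.L_comm l j i]
  linear_combination X.θ * (X.D₃ i X.N * X.g j l - X.D₃ j X.N * X.g i l) * X.N_inv

lemma R_stss (l i j : Fin 3) : X.R (Sum.inr l) (Sum.inl ()) (Sum.inr i) (Sum.inr j)
    = -(X.N * (X.D₃ j X.θ * X.g i l - X.D₃ i X.θ * X.g j l)) := by
  rw [R, riemLow_antisymm_left X.comm X.met_symm X.met_inv, ← R_tsss]

/-- Gauss equation. -/
lemma R_ssss (k l i j : Fin 3) : X.R (Sum.inr k) (Sum.inr l) (Sum.inr i) (Sum.inr j)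
    = X.K k l i j + X.θ ^ 2 * (X.g i k * X.g j l - X.g j k * X.g i l) := by
  rw [R, riemLow_eq X.met_symm X.met_inv, K, riemLow_eq X.symm X.inv]
  simp only [chrLow_tss, Fintype.sum_sum_type, chr_tss, chr_sss, chrLow_sss,
    Finset.univ_unique, Finset.sum_singleton, PUnit.default_eq_unit]
  linear_combination X.θ ^ 2 * (X.g i k * X.g j l - X.g j k * X.g i l) * X.N_inv

/-- The Riccati equation of the foliation. It is the link between the electric curvature and the
Hessian of the lapse, which drives the evolution of the slices. -/
lemma R_tsts (l j : Fin 3) : X.R (Sum.inl ()) (Sum.inr l) (Sum.inl ()) (Sum.inr j)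
    = X.N * X.hess l j - (X.N * X.D₀ X.θ + X.N ^ 2 * X.θ ^ 2) * X.g l j := by
  rw [R, riemLow_eq X.met_symm X.met_inv]
  simp only [chrLow_tss, chrLow_tts, chrLow_ttt, chrLow_stt, Fintype.sum_sum_type, chrLow_tst,
    chrLow_sst, chr_tss, chr_sss, chr_tts, chr_sts,
    Finset.univ_unique, Finset.sum_singleton, map_neg, Derivation.leibniz, smul_eq_mul,
    Finset.sum_sub_distrib, mul_assoc, ← Finset.mul_sum, PUnit.default_eq_unit, dt_g, hess,
    mul_ite, mul_zero, Finset.sum_ite_eq', Finset.mem_univ, if_true]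
  have h : ∑ m, X.D₃ m X.N * X.Γ m j l = ∑ m, X.Γ m j l * X.D₃ m X.N :=
    Finset.sum_congr rfl fun m _ => mul_comm _ _
  rw [h, X.symm.apply l j]
  linear_combination (X.θ * X.D₀ X.N * X.g l j - X.D₃ j X.N * X.D₃ l X.N) * X.N_inv

lemma D_two (a : Idx) : X.D a (2 : A) = 0 := by
  rw [show (2 : A) = algebraMap ℝ A 2 from (map_ofNat _ 2).symm, Derivation.map_algebraMap]

/-- Commute ∂_t past the spatial derivatives in the Koszul formula. -/
lemma dt_L (k j l : Fin 3) : X.D₀ (X.L k j l) = 2 * (X.N * X.θ) * X.L k j l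
    + X.D₃ j (X.N * X.θ) * X.g l k + X.D₃ l (X.N * X.θ) * X.g j k
    - X.D₃ k (X.N * X.θ) * X.g j l := by
  have h := congrArg X.D₀ (two_chrLow (D := X.D₃) X.inv k j l)
  rw [two_mul, map_add, ← two_mul, map_sub, map_add, X.comm, X.comm _ (Sum.inr l),
    X.comm _ (Sum.inr k), dt_g, dt_g, dt_g] at h
  apply eq_of_two_mul_eq
  rw [h]
  simp only [Derivation.leibniz, smul_eq_mul, D_two, D_g]
  rw [X.L_comm k l j, X.L_comm j l k, X.L_comm l k j]
  ring

/-- Pair symmetry of the curvature is not used anywhere, so this block is computed separately from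
`R_tsss`. -/
lemma R_ssts (hθ : ∀ i, X.D₃ i X.θ = 0) (k l j : Fin 3) :
    X.R (Sum.inr k) (Sum.inr l) (Sum.inl ()) (Sum.inr j) = 0 := by
  rw [R, riemLow_eq X.met_symm X.met_inv]
  simp only [chrLow_sss, chrLow_sts, chrLow_tts, chrLow_tss, Fintype.sum_sum_type,
    chr_tss, chr_sss, chr_tts, chr_sts,
    Finset.univ_unique, Finset.sum_singleton, Derivation.leibniz, smul_eq_mul, D_g,
    Finset.sum_sub_distrib, mul_assoc, ← Finset.mul_sum, PUnit.default_eq_unit, sum_g_mul_Γ,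
    mul_ite, mul_zero, Finset.sum_ite_eq', Finset.mem_univ, if_true, dt_L, hθ]
  rw [X.symm.apply k l]
  linear_combination X.θ * (X.D₃ k X.N * X.g j l - X.D₃ l X.N * X.g j k) * X.N_inv

end UmbilicData

/-! ### Evolution of the intrinsic curvature of the slices -/

namespace UmbilicData

variable {A : Type*} [CommRing A] [Algebra ℝ A] (X : UmbilicData A)

/-- Differentiate g g⁻¹ = 1 and multiply by g⁻¹ from the left. -/
lemma dt_gi (i j : Fin 3) : X.D₀ (X.gi i j) = -(2 * (X.N * X.θ) * X.gi i j) := by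
  have h : ∀ k, ∑ l, X.g k l * (X.D₀ (X.gi l j) + 2 * (X.N * X.θ) * X.gi l j) = 0 := by
    intro k
    have h := congrArg (fun M => X.D₀ (M k j)) X.inv
    simp only [Matrix.mul_apply, map_sum, Derivation.leibniz, smul_eq_mul, dt_g,
      Matrix.one_apply] at h
    rw [show X.D₀ (if k = j then (1 : A) else 0) = 0 by split_ifs <;> simp] at h
    rw [← h]
    exact Finset.sum_congr rfl fun l _ => by ring
  have h2 : ∑ k, X.gi i k * ∑ l, X.g k l * (X.D₀ (X.gi l j) + 2 * (X.N * X.θ) * X.gi l j) = 0 := by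
    simp [h]
  simp only [Finset.mul_sum] at h2
  rw [Finset.sum_comm] at h2
  simp only [← mul_assoc, ← Finset.sum_mul, X.sum_gi_mul_g, ite_mul, one_mul, zero_mul,
    Finset.sum_ite_eq, Finset.mem_univ, if_true] at h2
  linear_combination h2

lemma Γ_eq (k i j : Fin 3) : X.Γ k i j = ∑ m, X.gi k m * X.L m i j := by
  simp only [chrLow, Finset.mul_sum]
  rw [Finset.sum_comm]
  simp only [← mul_assoc, ← Finset.sum_mul, X.sum_gi_mul_g, ite_mul, one_mul, zero_mul,
    Finset.sum_ite_eq, Finset.mem_univ, if_true]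

lemma hess_symm (l j : Fin 3) : X.hess l j = X.hess j l := by
  unfold hess
  rw [X.comm]
  congr 1
  exact Finset.sum_congr rfl fun m _ => by rw [Γ, chr_comm X.symm]

/-- The time derivative of the lowered Christoffel symbols, up to the conformal weight. -/
def dL (k j l : Fin 3) : A :=
  X.θ * (X.D₃ j X.N * X.g l k + X.D₃ l X.N * X.g j k - X.D₃ k X.N * X.g j l)

lemma dt_L_eq (hθ : ∀ i, X.D₃ i X.θ = 0) (k j l : Fin 3) :
    X.D₀ (X.L k j l) = 2 * (X.N * X.θ) * X.L k j l + X.dL k j l := by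
  rw [dt_L, dL]
  simp only [Derivation.leibniz, smul_eq_mul, hθ]
  ring

/-- The sum is g⁻¹ contracted with two lowered symbols, of conformal weight -2 + 2 + 2 = 2. The
remaining terms come from the inhomogeneous part `dL` of each factor. -/
lemma dt_L_mul_Γ (hθ : ∀ i, X.D₃ i X.θ = 0) (a b c d : Fin 3) :
    X.D₀ (∑ m, X.L m a b * X.Γ m c d) = 2 * (X.N * X.θ) * ∑ m, X.L m a b * X.Γ m c d
      + ∑ m, X.dL m a b * X.Γ m c d + ∑ m, X.dL m c d * X.Γ m a b := by
  have h : ∑ m, X.dL m c d * X.Γ m a b = ∑ m, ∑ n, X.gi m n * X.L m a b * X.dL n c d := by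
    simp only [Γ_eq, Finset.mul_sum]
    rw [Finset.sum_comm]
    refine Finset.sum_congr rfl fun m _ => Finset.sum_congr rfl fun n _ => ?_
    rw [X.gi_symm.apply]
    ring
  rw [h]
  simp only [Γ_eq, Finset.mul_sum, ← Finset.sum_add_distrib, map_sum, Derivation.leibniz,
    smul_eq_mul, dt_gi, X.dt_L_eq hθ]
  exact Finset.sum_congr rfl fun m _ => Finset.sum_congr rfl fun n _ => by ring

lemma sum_dL_mul_Γ (a b c d : Fin 3) : ∑ m, X.dL m a b * X.Γ m c d
    = X.θ * (X.D₃ a X.N * X.L b c d + X.D₃ b X.N * X.L a c d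
      - X.g a b * ∑ m, X.Γ m c d * X.D₃ m X.N) := by
  simp only [← X.sum_g_mul_Γ, Finset.mul_sum, ← Finset.sum_add_distrib,
    ← Finset.sum_sub_distrib, dL]
  refine Finset.sum_congr rfl fun m _ => ?_
  rw [X.symm.apply m b, X.symm.apply m a]
  ring

/-- The evolution of the curvature of the slices. -/
lemma dt_K (hθ : ∀ i, X.D₃ i X.θ = 0) (k l i j : Fin 3) :
    X.D₀ (X.K k l i j) = 2 * (X.N * X.θ) * X.K k l i j
      + X.θ * (X.hess i l * X.g j k + X.hess j k * X.g i l
        - X.hess i k * X.g j l - X.hess j l * X.g i k) := by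
  -- This is the first variation of the curvature under g ↦ e^{2u} g with u = Nθ, where Hess u = θ
  -- Hess N because θ is spatially constant. The swaps put the second derivatives of N in the order
  -- in which differentiating `dL` produces them.
  rw [X.hess_symm i l, X.hess_symm j k, X.hess_symm i k, X.hess_symm j l]
  rw [K, riemLow_eq X.symm X.inv, Finset.sum_sub_distrib]
  rw [map_sub, map_sub, map_sub, X.dt_L_mul_Γ hθ, X.dt_L_mul_Γ hθ, X.comm _ (Sum.inr i),
    X.comm _ (Sum.inr j), X.dt_L_eq hθ, X.dt_L_eq hθ]
  simp only [sum_dL_mul_Γ]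
  simp only [hess, dL, map_add, map_sub, Derivation.leibniz, smul_eq_mul, hθ, D_g, D_two]
  simp only [X.symm.apply k l, X.L_comm k j i, X.L_comm l j i,
    X.comm (Sum.inr j) (Sum.inr i)]
  ring

/-- The Ricci tensor of the slices. -/
def ric (l j : Fin 3) : A := ∑ k, ∑ i, X.gi k i * X.K k l i j

/-- The Laplacian of the lapse on the slices. -/
def lap : A := ∑ k, ∑ i, X.gi k i * X.hess k i

/-- The scalar curvature of the slices. -/
def scal : A := ∑ l, ∑ j, X.gi l j * X.ric l j

/-- Three times the trace-free part of the Ricci tensor of the slices. -/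
def ricTF (l j : Fin 3) : A := 3 * X.ric l j - X.scal * X.g l j

lemma trace_g : ∑ k, ∑ i, X.gi k i * X.g k i = 3 := by
  have : ∀ k, ∑ i, X.gi k i * X.g k i = 1 := fun k => by
    have h := X.sum_gi_mul_g k k
    rw [if_pos rfl] at h
    rw [← h]
    exact Finset.sum_congr rfl fun i _ => by rw [X.symm.apply i k]
  simp [this]

lemma sum_gi_mul_mul_g (f : Fin 3 → A) (j : Fin 3) :
    ∑ k, ∑ i, X.gi k i * (f i * X.g j k) = f j := by
  rw [Finset.sum_comm]
  have : ∀ i, ∑ k, X.gi k i * (f i * X.g j k) = f i * ∑ k, X.gi i k * X.g k j := fun i => by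
    rw [Finset.mul_sum]
    refine Finset.sum_congr rfl fun k _ => ?_
    rw [X.gi_symm.apply i k, X.symm.apply k j]
    ring
  simp [this, X.sum_gi_mul_g]

lemma sum_gi_mul_mul_g' (f : Fin 3 → A) (j : Fin 3) :
    ∑ k, ∑ i, X.gi k i * (f k * X.g i j) = f j := by
  rw [← X.sum_gi_mul_mul_g f j, Finset.sum_comm]
  refine Finset.sum_congr rfl fun k _ => Finset.sum_congr rfl fun i _ => ?_
  rw [X.gi_symm.apply k i, X.symm.apply j k]

lemma sum_gi_mul_const_mul_g (c : A) : ∑ k, ∑ i, X.gi k i * (c * X.g k i) = 3 * c := by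
  rw [← X.trace_g]
  simp only [Finset.sum_mul]
  exact Finset.sum_congr rfl fun k _ => Finset.sum_congr rfl fun i _ => by ring

lemma dt_contract (f : Fin 3 → Fin 3 → A) : X.D₀ (∑ k, ∑ i, X.gi k i * f k i)
    = -(2 * (X.N * X.θ) * ∑ k, ∑ i, X.gi k i * f k i) + ∑ k, ∑ i, X.gi k i * X.D₀ (f k i) := by
  simp only [Finset.mul_sum, ← Finset.sum_neg_distrib, ← Finset.sum_add_distrib, map_sum,
    Derivation.leibniz, smul_eq_mul, dt_gi]
  exact Finset.sum_congr rfl fun m _ => Finset.sum_congr rfl fun n _ => by ring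

/-- The conformal variation -(n-2) Hess u - (Δu) g of the Ricci tensor, with n = 3 and u = Nθ. -/
lemma dt_ric (hθ : ∀ i, X.D₃ i X.θ = 0) (l j : Fin 3) :
    X.D₀ (X.ric l j) = -(X.θ * (X.hess l j + X.lap * X.g l j)) := by
  have h1 := X.sum_gi_mul_mul_g (fun i => X.hess i l) j
  have h2 := X.sum_gi_mul_mul_g' (fun k => X.hess j k) l
  have h3 := X.sum_gi_mul_const_mul_g (X.hess j l)
  have h4 : ∑ k, ∑ i, X.gi k i * (X.hess i k * X.g j l) = X.lap * X.g l j := by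
    simp only [lap, Finset.sum_mul]
    refine Finset.sum_congr rfl fun k _ => Finset.sum_congr rfl fun i _ => ?_
    rw [X.hess_symm i k, X.symm.apply l j]
    ring
  have h5 : ∑ k, ∑ i, X.gi k i * X.D₀ (X.K k l i j) = 2 * (X.N * X.θ) * X.ric l j
      + X.θ * (∑ k, ∑ i, X.gi k i * (X.hess i l * X.g j k)
        + ∑ k, ∑ i, X.gi k i * (X.hess j k * X.g i l)
        - ∑ k, ∑ i, X.gi k i * (X.hess i k * X.g j l)
        - ∑ k, ∑ i, X.gi k i * (X.hess j l * X.g k i)) := by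
    simp only [ric, Finset.mul_sum, ← Finset.sum_add_distrib, ← Finset.sum_sub_distrib]
    refine Finset.sum_congr rfl fun k _ => Finset.sum_congr rfl fun i _ => ?_
    rw [X.dt_K hθ, X.symm.apply i k]
    ring
  rw [ric, dt_contract, h5, h1, h2, h3, h4, ← ric, X.hess_symm l j]
  ring

lemma dt_scal (hθ : ∀ i, X.D₃ i X.θ = 0) :
    X.D₀ X.scal = -(2 * (X.N * X.θ) * X.scal) - 4 * (X.θ * X.lap) := by
  have h : ∑ l, ∑ j, X.gi l j * X.D₀ (X.ric l j)
      = -(X.θ * (X.lap + ∑ l, ∑ j, X.gi l j * (X.lap * X.g l j))) := by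
    conv_rhs => rw [lap]
    simp only [Finset.mul_sum, ← Finset.sum_add_distrib, ← Finset.sum_neg_distrib, X.dt_ric hθ]
    refine Finset.sum_congr rfl fun k _ => Finset.sum_congr rfl fun i _ => ?_
    rw [← lap]
    ring
  rw [scal, dt_contract, h, sum_gi_mul_const_mul_g, ← scal]
  ring

/-- The terms of conformal weight in scal · g cancel, and only the trace-free Hessian of the lapse
is left. -/
lemma dt_ricTF (hθ : ∀ i, X.D₃ i X.θ = 0) (l j : Fin 3) :
    X.D₀ (X.ricTF l j) = -(X.θ * (3 * X.hess l j - X.lap * X.g l j)) := by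
  have h3 : X.D₀ (3 : A) = 0 := by
    rw [show (3 : A) = algebraMap ℝ A 3 from (map_ofNat _ 3).symm, Derivation.map_algebraMap]
  simp only [ricTF, map_sub, Derivation.leibniz, smul_eq_mul, h3, X.dt_ric hθ, X.dt_scal hθ, dt_g]
  ring

end UmbilicData

/-! ### The differential ring of smooth functions on a set -/

section SmoothFunctions

variable {E : Type*} {S : Set E}

/-- Extension of a function on `S` by zero. -/
def extendZero (f : S → ℝ) : E → ℝ := Function.extend Subtype.val f 0

@[simp] lemma extendZero_apply (f : S → ℝ) (p : S) : extendZero f p = f p :=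
  Subtype.val_injective.extend_apply f 0 p

lemma extendZero_eqOn {f : S → ℝ} {F : E → ℝ} (h : ∀ p : S, f p = F p) :
    Set.EqOn (extendZero f) F S := fun p hp => by
  exact (extendZero_apply f ⟨p, hp⟩).trans (h ⟨p, hp⟩)

variable [NormedAddCommGroup E] [NormedSpace ℝ E]

variable (S) in
/-- The algebra of smooth functions on `S`. -/
def smoothFun : Subalgebra ℝ (S → ℝ) where
  -- Elements live on the subtype, so they are equal as soon as they agree on S. The extension by
  -- zero only supplies a function on E whose derivative within S can be taken.
  carrier := {f | ContDiffOn ℝ ∞ (extendZero f) S}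
  mul_mem' {f g} hf hg := (ContDiffOn.mul hf hg).congr (extendZero_eqOn fun p => by simp)
  add_mem' {f g} hf hg := (ContDiffOn.add hf hg).congr (extendZero_eqOn fun p => by simp)
  algebraMap_mem' c := (contDiffOn_const (c := c)).congr (extendZero_eqOn fun p => by simp)

/-- The element of `smoothFun S` defined by a function that is smooth on `S`. -/
def smoothFun.mk (F : E → ℝ) (hF : ContDiffOn ℝ ∞ F S) : smoothFun S :=
  ⟨fun p => F p, hF.congr (extendZero_eqOn fun _ => rfl)⟩

lemma smoothFun.contDiffOn (f : smoothFun S) : ContDiffOn ℝ ∞ (extendZero f.1) S := f.2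

lemma smoothFun.differentiableWithinAt (f : smoothFun S) {p : E} (hp : p ∈ S) :
    DifferentiableWithinAt ℝ (extendZero f.1) S p :=
  ((smoothFun.contDiffOn f).differentiableOn (by simp)) p hp

lemma smoothFun.contDiffOn_fderivWithin (hS : UniqueDiffOn ℝ S) (f : smoothFun S) :
    ContDiffOn ℝ ∞ (fderivWithin ℝ (extendZero f.1) S) S :=
  (smoothFun.contDiffOn f).fderivWithin hS (by simp)

/-- The directional derivative on smooth functions. -/
def smoothDeriv (hS : UniqueDiffOn ℝ S) (v : E) : Derivation ℝ (smoothFun S) (smoothFun S) :=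
  Derivation.mk'
    { toFun := fun f => smoothFun.mk (fun p => fderivWithin ℝ (extendZero f.1) S p v)
        ((smoothFun.contDiffOn_fderivWithin hS f).clm_apply contDiffOn_const)
      map_add' := fun f g => by
        ext p
        have h : fderivWithin ℝ (extendZero (f + g).1) S p
            = fderivWithin ℝ (extendZero f.1 + extendZero g.1) S p :=
          fderivWithin_congr' (extendZero_eqOn fun p => by simp) p.2
        change fderivWithin ℝ (extendZero (f + g).1) S p v = _
        rw [h, fderivWithin_add (hS p p.2) (smoothFun.differentiableWithinAt f p.2)
          (smoothFun.differentiableWithinAt g p.2)]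
        rfl
      map_smul' := fun c f => by
        ext p
        have h : fderivWithin ℝ (extendZero (c • f).1) S p
            = fderivWithin ℝ (c • extendZero f.1) S p :=
          fderivWithin_congr' (extendZero_eqOn fun p => by simp) p.2
        change fderivWithin ℝ (extendZero (c • f).1) S p v = _
        rw [h, fderivWithin_const_smul (hS p p.2) (smoothFun.differentiableWithinAt f p.2)]
        rfl }
    (fun f g => by
      ext p
      have h : fderivWithin ℝ (extendZero (f * g).1) S p
          = fderivWithin ℝ (extendZero f.1 * extendZero g.1) S p :=
        fderivWithin_congr' (extendZero_eqOn fun p => by simp) p.2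
      change fderivWithin ℝ (extendZero (f * g).1) S p v = _
      rw [h, fderivWithin_mul (hS p p.2) (smoothFun.differentiableWithinAt f p.2)
        (smoothFun.differentiableWithinAt g p.2)]
      simp [smoothFun.mk])

lemma smoothDeriv_apply (hS : UniqueDiffOn ℝ S) (v : E) (f : smoothFun S) (p : S) :
    (smoothDeriv hS v f).1 p = fderivWithin ℝ (extendZero f.1) S p v := rfl

/-- Boundary points are allowed, as I may contain its endpoints. Second derivatives within S are
still symmetric there, since these points are limits of interior ones. -/
lemma smoothDeriv_comm (hS : UniqueDiffOn ℝ S) (hS' : S ⊆ closure (interior S)) (v w : E)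
    (f : smoothFun S) :
    smoothDeriv hS v (smoothDeriv hS w f) = smoothDeriv hS w (smoothDeriv hS v f) := by
  have key : ∀ (v w : E) (p : S), (smoothDeriv hS v (smoothDeriv hS w f)).1 p
      = fderivWithin ℝ (fderivWithin ℝ (extendZero f.1) S) S p v w := by
    intro v w p
    have h0 : fderivWithin ℝ (extendZero (smoothDeriv hS w f).1) S p
        = fderivWithin ℝ (fun q => fderivWithin ℝ (extendZero f.1) S q w) S p :=
      fderivWithin_congr' (extendZero_eqOn fun q => rfl) p.2
    rw [smoothDeriv_apply, h0]
    have h := ((smoothFun.contDiffOn_fderivWithin hS f).differentiableOn (by simp) p p.2)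
    rw [fderivWithin_clm_apply (hS p p.2) h (differentiableWithinAt_const _)]
    simp
  ext p
  rw [key, key]
  exact ((smoothFun.contDiffOn f p p.2).isSymmSndFDerivWithinAt
    (by rw [minSmoothness_of_isRCLikeNormedField]; exact WithTop.coe_le_coe.2 le_top) hS (hS' p.2) p.2) v w

end SmoothFunctions

/-! ### Smooth functions on `I × U` -/

section Domain

variable {I : Set ℝ} {U : Set E3}

lemma interval_interior_nonempty (hI : I.OrdConnected) (hI' : I.Nontrivial) :
    (interior I).Nonempty := by
  obtain ⟨a, ha, b, hb, hab⟩ := hI'.exists_lt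
  refine ⟨(a + b) / 2, interior_mono (hI.out ha hb) ?_⟩
  rw [interior_Icc]
  constructor <;> linarith

lemma interval_uniqueDiffOn (hI : I.OrdConnected) (hI' : I.Nontrivial) : UniqueDiffOn ℝ I :=
  uniqueDiffOn_convex hI.convex (interval_interior_nonempty hI hI')

lemma domain_uniqueDiffOn (hI : I.OrdConnected) (hI' : I.Nontrivial) (hU : IsOpen U) :
    UniqueDiffOn ℝ (I ×ˢ U) :=
  (interval_uniqueDiffOn hI hI').prod hU.uniqueDiffOn

lemma domain_subset_closure (hI : I.OrdConnected) (hI' : I.Nontrivial) (hU : IsOpen U) :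
    I ×ˢ U ⊆ closure (interior (I ×ˢ U)) := by
  rw [interior_prod_eq, closure_prod_eq, hU.interior_eq,
    (hI.convex (𝕜 := ℝ)).closure_interior_eq_closure_of_nonempty_interior
      (interval_interior_nonempty hI hI')]
  exact Set.prod_mono subset_closure subset_closure

/-- The coordinate directions of `ℝ × ℝ³`. -/
def dir : Idx → ℝ × E3
  | Sum.inl _ => (1, 0)
  | Sum.inr i => (0, EuclideanSpace.single i 1)

/-- Evaluation of a smooth function at a point. -/
def ev (p : ↥(I ×ˢ U)) : smoothFun (I ×ˢ U) →ₐ[ℝ] ℝ :=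
  (Pi.evalAlgHom ℝ _ p).comp (smoothFun (I ×ˢ U)).val

lemma ev_ext {a b : smoothFun (I ×ˢ U)} (h : ∀ p, ev p a = ev p b) : a = b :=
  Subtype.ext (funext h)

/-- Restrict the derivative within I × U to coordinate lines and slices. In time this gives the
derivative within I; in space U is open and the full derivative results. -/
lemma pd_eq (hI : I.OrdConnected) (hI' : I.Nontrivial) (hU : IsOpen U) (α : Idx)
    {f : ℝ → E3 → ℝ} {a : smoothFun (I ×ˢ U)} (h : ∀ p, ev p a = f p.1.1 p.1.2)
    (p : ↥(I ×ˢ U)) :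
    pd I α f p.1.1 p.1.2
      = ev p (smoothDeriv (domain_uniqueDiffOn hI hI' hU) (dir α) a) := by
  obtain ⟨⟨t, y⟩, ht, hy⟩ := p
  have hF := (smoothFun.differentiableWithinAt a (p := (t, y)) ⟨ht, hy⟩).hasFDerivWithinAt
  have hext : ∀ s ∈ I, ∀ z ∈ U, f s z = extendZero a.1 (s, z) := fun s hs z hz =>
    ((extendZero_apply a.1 ⟨(s, z), hs, hz⟩).trans (h _)).symm
  change _ = fderivWithin ℝ (extendZero a.1) (I ×ˢ U) (t, y) (dir α)
  match α with
  | Sum.inl _ =>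
    have h1 : HasDerivWithinAt (fun s : ℝ => (s, y)) ((1 : ℝ), (0 : E3)) I t :=
      (hasDerivWithinAt_id t I).prodMk (hasDerivWithinAt_const t I y)
    have h2 := hF.comp_hasDerivWithinAt (s := I) t h1 (fun s hs => Set.mk_mem_prod hs hy)
    have h3 := h2.congr (f₁ := fun s => f s y) (fun s hs => hext s hs y hy) (hext t ht y hy)
    exact h3.derivWithin (interval_uniqueDiffOn hI hI' t ht)
  | Sum.inr i =>
    have h1 : HasFDerivWithinAt (fun z : E3 => (t, z)) (ContinuousLinearMap.inr ℝ ℝ E3) U y :=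
      (hasFDerivAt_prodMk_right t y).hasFDerivWithinAt
    have h2 := HasFDerivWithinAt.comp (t := I ×ˢ U) y hF h1 (fun z hz => Set.mk_mem_prod ht hz)
    have h3 := (h2.congr (f₁ := f t) (fun z hz => hext t ht z hz) (hext t ht y hy)).hasFDerivAt
      (hU.mem_nhds hy)
    change fderiv ℝ (f t) y _ = _
    rw [h3.fderiv]
    simp [dir]

/-- `f` is represented by the smooth function `a` on `I × U`. -/
def Repr (f : ℝ → E3 → ℝ) (a : smoothFun (I ×ˢ U)) : Prop := ∀ p, ev p a = f p.1.1 p.1.2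

/-- The coordinate derivations. -/
def coordDeriv (hI : I.OrdConnected) (hI' : I.Nontrivial) (hU : IsOpen U) (α : Idx) :
    Derivation ℝ (smoothFun (I ×ˢ U)) (smoothFun (I ×ˢ U)) :=
  smoothDeriv (domain_uniqueDiffOn hI hI' hU) (dir α)

section

variable (hI : I.OrdConnected) (hI' : I.Nontrivial) (hU : IsOpen U)

lemma Repr.pd (α : Idx) {f : ℝ → E3 → ℝ} {a : smoothFun (I ×ˢ U)} (h : Repr f a) :
    Repr (pd I α f) (coordDeriv hI hI' hU α a) :=
  fun p => (pd_eq hI hI' hU α h p).symm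

variable {γ : ℝ → E3 → Matrix Idx Idx ℝ} {G Gi : Matrix Idx Idx (smoothFun (I ×ˢ U))}
  (hG : ∀ a b, Repr (fun t y => γ t y a b) (G a b))
  (hGi : ∀ a b, Repr (fun t y => (γ t y)⁻¹ a b) (Gi a b))

include hG hGi in
lemma repr_christoffel (ρ μ ν : Idx) :
    Repr (christoffel I γ ρ μ ν) (chr (coordDeriv hI hI' hU) G Gi ρ μ ν) := by
  intro p
  simp only [chr, map_mul, map_sum, map_add, map_sub, AlgHom.commutes, christoffel,
    ((hG _ _).pd hI hI' hU _ p), (hGi _ _ p), Algebra.algebraMap_self, RingHom.id_apply]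

include hG hGi in
lemma repr_riemann (a b c d : Idx) :
    Repr (riemann I γ a b c d) (riemLow (coordDeriv hI hI' hU) G Gi a b c d) := by
  intro p
  have hc := repr_christoffel hI hI' hU hG hGi
  simp only [riemLow, riemUp, map_mul, map_sum, map_add, map_sub, riemann, riemannUp,
    ((hc _ _ _).pd hI hI' hU _ p), (hG _ _ p), (hc _ _ _ p)]

end
end Domain

/-! ### The metric `-n² dt² + e^{2σ} q` in coordinates -/

section Coordinate

lemma contDiffOn_det {E : Type*} [NormedAddCommGroup E] [NormedSpace ℝ E] {S : Set E}
    {q : E → Matrix (Fin 3) (Fin 3) ℝ} (hq : ∀ i j, ContDiffOn ℝ ∞ (fun y => q y i j) S) :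
    ContDiffOn ℝ ∞ (fun y => (q y).det) S := by
  simp only [Matrix.det_apply']
  exact ContDiffOn.sum fun π _ => contDiffOn_const.mul (contDiffOn_prod fun i _ => hq _ _)

/-- Cramer's rule: the entries of the inverse are quotients of determinants. -/
lemma contDiffOn_inv_entry {E : Type*} [NormedAddCommGroup E] [NormedSpace ℝ E] {S : Set E}
    {q : E → Matrix (Fin 3) (Fin 3) ℝ} (hq : ∀ i j, ContDiffOn ℝ ∞ (fun y => q y i j) S)
    (h0 : ∀ y ∈ S, (q y).det ≠ 0) (i j : Fin 3) :
    ContDiffOn ℝ ∞ (fun y => (q y)⁻¹ i j) S := by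
  have h : ∀ y, (q y)⁻¹ i j = (q y).det⁻¹ * ((q y).updateRow j (Pi.single i 1)).det := fun y => by
    rw [Matrix.inv_def, Matrix.smul_apply, Ring.inverse_eq_inv', Matrix.adjugate_apply, smul_eq_mul]
  simp only [h]
  refine ((contDiffOn_det hq).inv h0).mul (contDiffOn_det fun a b => ?_)
  by_cases ha : a = j
  · subst ha
    simp only [Matrix.updateRow_self]
    exact contDiffOn_const
  · simp only [Matrix.updateRow_ne ha]
    exact hq a b

/-- The coefficients of a metric `-n² dt² + e^{2σ} q` on `I × U`. -/
structure CoordMetric (I : Set ℝ) (U : Set E3) where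
  ordConnected : I.OrdConnected
  nontrivial : I.Nontrivial
  isOpen : IsOpen U
  n : ℝ → E3 → ℝ
  σ : ℝ → E3 → ℝ
  q : E3 → Matrix (Fin 3) (Fin 3) ℝ
  n_smooth : ContDiffOn ℝ ∞ (fun p : ℝ × E3 => n p.1 p.2) (I ×ˢ U)
  σ_smooth : ContDiffOn ℝ ∞ (fun p : ℝ × E3 => σ p.1 p.2) (I ×ˢ U)
  q_smooth : ∀ i j, ContDiffOn ℝ ∞ (fun y => q y i j) U
  n_pos : ∀ t ∈ I, ∀ y ∈ U, 0 < n t y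
  q_posDef : ∀ y ∈ U, (q y).PosDef

namespace CoordMetric

variable {I : Set ℝ} {U : Set E3} (C : CoordMetric I U)

/-- The metric of the slices. -/
def g (t : ℝ) (y : E3) : Matrix (Fin 3) (Fin 3) ℝ := Real.exp (2 * C.σ t y) • C.q y

/-- The spacetime metric. -/
def γ (t : ℝ) (y : E3) : Matrix Idx Idx ℝ :=
  Matrix.fromBlocks (Matrix.of fun _ _ => -(C.n t y) ^ 2) 0 0 (C.g t y)

/-- The time derivative of the conformal factor. -/
def s (t : ℝ) (y : E3) : ℝ := derivWithin (fun t => C.σ t y) I t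

lemma q_smooth' (i j : Fin 3) : ContDiffOn ℝ ∞ (fun p : ℝ × E3 => C.q p.2 i j) (I ×ˢ U) :=
  (C.q_smooth i j).comp contDiffOn_snd fun _ hp => hp.2

/-- The time coordinate derivation. -/
abbrev D (α : Idx) : Derivation ℝ (smoothFun (I ×ˢ U)) (smoothFun (I ×ˢ U)) :=
  coordDeriv C.ordConnected C.nontrivial C.isOpen α

/-- The conformal exponent as a smooth function. -/
def σA : smoothFun (I ×ˢ U) := smoothFun.mk _ C.σ_smooth

/-- The metric coefficients as smooth functions. -/
def gA : Matrix (Fin 3) (Fin 3) (smoothFun (I ×ˢ U)) := Matrix.of fun i j =>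
  smoothFun.mk (fun p : ℝ × E3 => Real.exp (2 * C.σ p.1 p.2) * C.q p.2 i j)
    (((contDiffOn_const.mul C.σ_smooth).exp).mul (C.q_smooth' i j))

/-- The coefficients of the inverse metric as smooth functions. -/
def giA : Matrix (Fin 3) (Fin 3) (smoothFun (I ×ˢ U)) := Matrix.of fun i j =>
  smoothFun.mk (fun p : ℝ × E3 => Real.exp (-(2 * C.σ p.1 p.2)) * (C.q p.2)⁻¹ i j)
    (((contDiffOn_const.mul C.σ_smooth).neg.exp).mul
      ((contDiffOn_inv_entry C.q_smooth (fun y hy => (C.q_posDef y hy).det_pos.ne') i j).comp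
        contDiffOn_snd fun _ hp => hp.2))

/-- The lapse as a smooth function. -/
def nA : smoothFun (I ×ˢ U) := smoothFun.mk _ C.n_smooth

/-- The inverse lapse as a smooth function. -/
def niA : smoothFun (I ×ˢ U) := smoothFun.mk _
  (C.n_smooth.inv fun p hp => (C.n_pos p.1 hp.1 p.2 hp.2).ne')

lemma ev_gA (p : ↥(I ×ˢ U)) (i j : Fin 3) : ev p (C.gA i j) = C.g p.1.1 p.1.2 i j := rfl

lemma g_inv {t : ℝ} {y : E3} (hy : y ∈ U) :
    (C.g t y)⁻¹ = Real.exp (-(2 * C.σ t y)) • (C.q y)⁻¹ := by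
  apply Matrix.inv_eq_right_inv
  rw [g, Matrix.smul_mul, Matrix.mul_smul, smul_smul, ← Real.exp_add, add_neg_cancel,
    Real.exp_zero, one_smul, Matrix.mul_nonsing_inv _ (C.q_posDef y hy).det_pos.ne'.isUnit]

lemma g_posDef {t : ℝ} {y : E3} (hy : y ∈ U) : (C.g t y).PosDef :=
  (C.q_posDef y hy).smul (Real.exp_pos _)

lemma ev_giA (p : ↥(I ×ˢ U)) (i j : Fin 3) : ev p (C.giA i j) = (C.g p.1.1 p.1.2)⁻¹ i j := by
  rw [C.g_inv p.2.2]
  rfl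

lemma ev_nA (p : ↥(I ×ˢ U)) : ev p C.nA = C.n p.1.1 p.1.2 := rfl

lemma ev_niA (p : ↥(I ×ˢ U)) : ev p C.niA = (C.n p.1.1 p.1.2)⁻¹ := rfl

lemma ev_dt_σA (p : ↥(I ×ˢ U)) : ev p (C.D (Sum.inl ()) C.σA) = C.s p.1.1 p.1.2 :=
  Repr.pd C.ordConnected C.nontrivial C.isOpen (Sum.inl ()) (f := C.σ) (fun _ => rfl) p

/-- Turns evolution identities in the ring back into ordinary derivatives along lines of constant
position. -/
lemma hasDerivWithinAt (a : smoothFun (I ×ˢ U)) {f : ℝ → E3 → ℝ} (h : Repr f a)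
    (p : ↥(I ×ˢ U)) :
    HasDerivWithinAt (fun t => f t p.1.2) (ev p (C.D (Sum.inl ()) a)) I p.1.1 := by
  obtain ⟨⟨t, y⟩, ht, hy⟩ := p
  have hF := (smoothFun.differentiableWithinAt a (p := (t, y)) ⟨ht, hy⟩).hasFDerivWithinAt
  have h1 : HasDerivWithinAt (fun s : ℝ => (s, y)) ((1 : ℝ), (0 : E3)) I t :=
    (hasDerivWithinAt_id t I).prodMk (hasDerivWithinAt_const t I y)
  have h2 := hF.comp_hasDerivWithinAt (s := I) t h1 (fun s hs => Set.mk_mem_prod hs hy)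
  have hext : ∀ s ∈ I, f s y = extendZero a.1 (s, y) := fun s hs =>
    ((extendZero_apply a.1 ⟨(s, y), hs, hy⟩).trans (h _)).symm
  exact h2.congr (fun s hs => hext s hs) (hext t ht)

lemma hasDerivWithinAt_σ {t : ℝ} {y : E3} (ht : t ∈ I) (hy : y ∈ U) :
    HasDerivWithinAt (fun t => C.σ t y) (C.s t y) I t := by
  have := C.hasDerivWithinAt C.σA (f := C.σ) (fun _ => rfl) ⟨(t, y), ht, hy⟩
  rwa [ev_dt_σA] at this

lemma dt_gA (i j : Fin 3) :
    C.D (Sum.inl ()) (C.gA i j) = 2 * C.D (Sum.inl ()) C.σA * C.gA i j := by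
  apply ev_ext
  rintro ⟨⟨t, y⟩, ht, hy⟩
  have h1 := C.hasDerivWithinAt (C.gA i j) (f := fun t y => C.g t y i j) (C.ev_gA · i j)
    ⟨(t, y), ht, hy⟩
  have h2 := (((C.hasDerivWithinAt_σ ht hy).const_mul 2).exp).mul_const (C.q y i j)
  rw [map_mul, map_mul, ev_dt_σA, ev_gA, map_ofNat]
  refine ((interval_uniqueDiffOn C.ordConnected C.nontrivial) t ht).eq_deriv I h1 (h2.congr_deriv ?_)
  simp only [g, Matrix.smul_apply, smul_eq_mul]
  ring

/-- The umbilic metric over the differential ring of smooth functions on `I × U`. -/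
def data : UmbilicData (smoothFun (I ×ˢ U)) where
  D := C.D
  comm a b x := smoothDeriv_comm _
    (domain_subset_closure C.ordConnected C.nontrivial C.isOpen) _ _ x
  g := C.gA
  gi := C.giA
  symm := by
    refine Matrix.ext fun i j => ev_ext fun p => ?_
    rw [Matrix.transpose_apply, ev_gA, ev_gA]
    exact ((C.g_posDef p.2.2).isHermitian.apply j i).symm
  inv := by
    refine Matrix.ext fun i j => ev_ext fun p => ?_
    have h := congrFun (congrFun (Matrix.mul_nonsing_inv (C.g p.1.1 p.1.2)
      (C.g_posDef p.2.2).det_pos.ne'.isUnit) i) j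
    simp only [Matrix.mul_apply, map_sum, map_mul, ev_gA, ev_giA] at h ⊢
    rw [h, Matrix.one_apply, Matrix.one_apply]
    split_ifs <;> simp
  N := C.nA
  Ni := C.niA
  N_inv := by
    apply ev_ext
    intro p
    rw [map_mul, ev_nA, ev_niA, map_one, mul_inv_cancel₀ (C.n_pos _ p.2.1 _ p.2.2).ne']
  -- From ∂_t (e^{2σ} q) = 2σ_t e^{2σ} q, so Nθ = σ_t.
  θ := C.niA * C.D (Sum.inl ()) C.σA
  dt_g i j := by
    rw [dt_gA, ← mul_assoc C.nA]
    have : C.nA * C.niA = 1 := by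
      apply ev_ext
      intro p
      rw [map_mul, ev_nA, ev_niA, map_one, mul_inv_cancel₀ (C.n_pos _ p.2.1 _ p.2.2).ne']
    rw [this, one_mul]

lemma ev_N (p : ↥(I ×ˢ U)) : ev p C.data.N = C.n p.1.1 p.1.2 := rfl
lemma ev_g (p : ↥(I ×ˢ U)) (i j : Fin 3) : ev p (C.data.g i j) = C.g p.1.1 p.1.2 i j := rfl
lemma ev_gi (p : ↥(I ×ˢ U)) (i j : Fin 3) : ev p (C.data.gi i j) = (C.g p.1.1 p.1.2)⁻¹ i j :=
  C.ev_giA p i j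
lemma ev_θ (p : ↥(I ×ˢ U)) : ev p C.data.θ = C.s p.1.1 p.1.2 / C.n p.1.1 p.1.2 := by
  change ev p (C.niA * C.D (Sum.inl ()) C.σA) = _
  rw [map_mul, ev_niA, ev_dt_σA]
  ring

lemma γ_inv {t : ℝ} {y : E3} (ht : t ∈ I) (hy : y ∈ U) : (C.γ t y)⁻¹ =
    Matrix.fromBlocks (Matrix.of fun _ _ => -((C.n t y)⁻¹) ^ 2) 0 0 (C.g t y)⁻¹ := by
  apply Matrix.inv_eq_right_inv
  rw [γ, Matrix.fromBlocks_multiply, Matrix.mul_nonsing_inv _ (C.g_posDef hy).det_pos.ne'.isUnit]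
  simp only [Matrix.mul_zero, Matrix.zero_mul, add_zero, zero_add]
  rw [← Matrix.fromBlocks_one]
  congr 1
  ext i j
  have := (C.n_pos t ht y hy).ne'
  simp [Matrix.mul_apply, this]

lemma repr_γ {γ' : ℝ → E3 → Matrix Idx Idx ℝ} (h : ∀ t ∈ I, ∀ y ∈ U, γ' t y = C.γ t y)
    (a b : Idx) : Repr (fun t y => γ' t y a b) (C.data.met a b) := by
  rintro ⟨⟨t, y⟩, ht, hy⟩
  simp only [h t ht y hy]
  rcases a with ⟨⟩ | i <;> rcases b with ⟨⟩ | j <;>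
    simp [UmbilicData.met, γ, ev_N, ev_g]

lemma repr_γ_inv {γ' : ℝ → E3 → Matrix Idx Idx ℝ} (h : ∀ t ∈ I, ∀ y ∈ U, γ' t y = C.γ t y)
    (a b : Idx) : Repr (fun t y => (γ' t y)⁻¹ a b) (C.data.metInv a b) := by
  rintro ⟨⟨t, y⟩, ht, hy⟩
  simp only [h t ht y hy, C.γ_inv ht hy]
  have : ∀ p, ev p C.data.Ni = (C.n p.1.1 p.1.2)⁻¹ := fun p => rfl
  rcases a with ⟨⟩ | i <;> rcases b with ⟨⟩ | j <;>
    simp [UmbilicData.metInv, this, ev_gi]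

lemma riemann_eq {γ' : ℝ → E3 → Matrix Idx Idx ℝ} (h : ∀ t ∈ I, ∀ y ∈ U, γ' t y = C.γ t y)
    (p : ↥(I ×ˢ U)) (a b c d : Idx) :
    riemann I γ' a b c d p.1.1 p.1.2 = ev p (C.data.R a b c d) :=
  (repr_riemann C.ordConnected C.nontrivial C.isOpen (C.repr_γ h) (C.repr_γ_inv h) a b c d p).symm

end CoordMetric
end Coordinate

/-! ### Tensor algebra at a point -/

section Pointwise

open scoped Matrix MatrixOrder Matrix.Norms.L2Operator

section Frame

variable {ι : Type*} [Fintype ι] (A : Matrix ι ι ℝ)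

/-- The components of a `(0,2)`-tensor in the frame `A`. -/
def frame2 (X : ι → ι → ℝ) (m n : ι) : ℝ := ∑ a, A a m * ∑ b, A b n * X a b

/-- The components of a `(0,4)`-tensor in the frame `A`. -/
def frame4 (P : ι → ι → ι → ι → ℝ) (m n r s : ι) : ℝ :=
  ∑ a, A a m * ∑ b, A b n * ∑ c, A c r * ∑ d, A d s * P a b c d

variable {A}

lemma eq_zero_of_frame [DecidableEq ι] (hA : IsUnit A.det) {f : ι → ℝ}
    (h : ∀ m, ∑ a, A a m * f a = 0) : f = 0 := by
  have h1 : Matrix.vecMul f A = 0 := by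
    ext m
    simpa [Matrix.vecMul, dotProduct, mul_comm] using h m
  have h2 := congrArg (fun v => Matrix.vecMul v A⁻¹) h1
  simpa [Matrix.vecMul_vecMul, Matrix.mul_nonsing_inv _ hA] using h2

lemma eq_zero_of_frame4 [DecidableEq ι] (hA : IsUnit A.det) {P : ι → ι → ι → ι → ℝ}
    (h : ∀ m n r s, frame4 A P m n r s = 0) (a b c d : ι) : P a b c d = 0 := by
  have h1 : ∀ n r s a, ∑ b, A b n * ∑ c, A c r * ∑ d, A d s * P a b c d = 0 := fun n r s a =>
    congrFun (eq_zero_of_frame hA fun m => h m n r s) a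
  have h2 : ∀ r s a b, ∑ c, A c r * ∑ d, A d s * P a b c d = 0 := fun r s a b =>
    congrFun (eq_zero_of_frame hA fun m => h1 m r s a) b
  have h3 : ∀ s a b c, ∑ d, A d s * P a b c d = 0 := fun s a b c =>
    congrFun (eq_zero_of_frame hA fun m => h2 m s a b) c
  exact congrFun (eq_zero_of_frame hA fun m => h3 m a b c) d

/-- A factorisation Q = B Bᵀ makes the quadratic form a sum of squares. It is applied to tensor
powers of g⁻¹ = A Aᵀ, with κ a product of index sets. -/
lemma sum_quadratic {κ : Type*} [Fintype κ] {Q B : κ → κ → ℝ}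
    (hQ : ∀ x y, Q x y = ∑ m, B x m * B y m) (f : κ → ℝ) :
    ∑ x, ∑ y, Q x y * (f x * f y) = ∑ m, (∑ x, B x m * f x) ^ 2 := by
  simp only [pow_two, Finset.sum_mul_sum]
  simp only [hQ, Finset.sum_mul]
  conv_rhs => rw [Finset.sum_comm]
  refine Finset.sum_congr rfl fun x _ => ?_
  rw [Finset.sum_comm]
  exact Finset.sum_congr rfl fun m _ => Finset.sum_congr rfl fun y _ => by ring

lemma mul_sum_four (f g h k : ι → ℝ) : (∑ m, f m) * (∑ m, g m) * (∑ m, h m) * (∑ m, k m)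
    = ∑ m, ∑ n, ∑ r, ∑ s, f m * g n * h r * k s := by
  simp only [← Finset.mul_sum, ← Finset.sum_mul]

lemma norm4_eq_frame {q : Matrix Idx Idx ℝ} {A : Matrix Idx Idx ℝ} (hq : q⁻¹ = A * Aᵀ)
    (P : Idx → Idx → Idx → Idx → ℝ) :
    norm4 q P = Real.sqrt (∑ m, ∑ n, ∑ r, ∑ s, frame4 A P m n r s ^ 2) := by
  have hq' : ∀ a b, q⁻¹ a b = ∑ m, A a m * A b m := fun a b => by
    rw [hq]; simp [Matrix.mul_apply]
  have h := sum_quadratic (κ := Idx × Idx × Idx × Idx)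
    (Q := fun x y => q⁻¹ x.1 y.1 * q⁻¹ x.2.1 y.2.1 * q⁻¹ x.2.2.1 y.2.2.1 * q⁻¹ x.2.2.2 y.2.2.2)
    (B := fun x m => A x.1 m.1 * A x.2.1 m.2.1 * A x.2.2.1 m.2.2.1 * A x.2.2.2 m.2.2.2)
    (fun x y => by
      simp only [hq', Fintype.sum_prod_type]
      rw [mul_sum_four]
      refine Finset.sum_congr rfl fun _ _ => ?_
      refine Finset.sum_congr rfl fun _ _ => ?_
      refine Finset.sum_congr rfl fun _ _ => ?_
      refine Finset.sum_congr rfl fun _ _ => ?_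
      ring) (fun x => P x.1 x.2.1 x.2.2.1 x.2.2.2)
  simp only [Fintype.sum_prod_type] at h
  unfold norm4
  refine congrArg Real.sqrt ?_
  simp only [frame4, Finset.mul_sum, mul_assoc] at h ⊢
  rw [h]

/-- The squared norm of a `(0,2)`-tensor. -/
def normSq2 (gi : Matrix ι ι ℝ) (X : ι → ι → ℝ) : ℝ :=
  ∑ a, ∑ b, ∑ a', ∑ b', gi a a' * gi b b' * (X a b * X a' b')

lemma normSq2_eq_frame {gi : Matrix ι ι ℝ} (hg : gi = A * Aᵀ) (X : ι → ι → ℝ) :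
    normSq2 gi X = ∑ m, ∑ n, frame2 A X m n ^ 2 := by
  have hq' : ∀ a b, gi a b = ∑ m, A a m * A b m := fun a b => by
    rw [hg]; simp [Matrix.mul_apply]
  have h := sum_quadratic (κ := ι × ι)
    (Q := fun x y => gi x.1 y.1 * gi x.2 y.2)
    (B := fun x m => A x.1 m.1 * A x.2 m.2)
    (fun x y => by
      simp only [hq', Fintype.sum_prod_type, Finset.sum_mul_sum]
      refine Finset.sum_congr rfl fun _ _ => ?_
      refine Finset.sum_congr rfl fun _ _ => ?_
      ring) (fun x => X x.1 x.2)
  simp only [Fintype.sum_prod_type] at h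
  rw [normSq2, h]
  simp only [frame2, Finset.mul_sum, mul_assoc]

/-- The columns of A form a g-orthonormal basis. -/
lemma exists_frame [DecidableEq ι] {g : Matrix ι ι ℝ} (hg : g.PosDef) :
    ∃ A : Matrix ι ι ℝ, IsUnit A.det ∧ g⁻¹ = A * Aᵀ ∧ Aᵀ * g * A = 1 := by
  obtain ⟨B, hB⟩ : ∃ B : Matrix ι ι ℝ, g⁻¹ = Bᴴ * B :=
    CStarAlgebra.nonneg_iff_eq_star_mul_self.mp hg.inv.posSemidef.nonneg
  rw [Matrix.conjTranspose_eq_transpose_of_trivial] at hB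
  have hdet : IsUnit (Bᵀ).det := by
    have h := hg.inv.det_pos.ne'
    rw [hB, Matrix.det_mul] at h
    exact (left_ne_zero_of_mul h).isUnit
  refine ⟨Bᵀ, hdet, by rwa [Matrix.transpose_transpose], ?_⟩
  rw [Matrix.transpose_transpose]
  have hdet' : IsUnit B.det := by rwa [Matrix.det_transpose] at hdet
  have h1 : g * (Bᵀ * B) = 1 := by rw [← hB, Matrix.mul_nonsing_inv _ hg.det_pos.ne'.isUnit]
  have h2 : B * (g * Bᵀ) * B = 1 * B := by
    rw [mul_assoc, mul_assoc g, h1, one_mul, mul_one]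
  have h3 := congrArg (· * B⁻¹) h2
  simpa [mul_assoc, Matrix.mul_nonsing_inv _ hdet'] using h3

end Frame
end Pointwise

/-! ### Ricci and Weyl tensors of a perfect fluid at a point -/

section FluidPoint

open scoped Matrix

/-- The Ricci contraction of a curvature-type tensor. -/
def ricOf (γ : Matrix Idx Idx ℝ) (R : Idx → Idx → Idx → Idx → ℝ) (b d : Idx) : ℝ :=
  ∑ a, ∑ c, γ⁻¹ a c * R a b c d

/-- The scalar contraction of a curvature-type tensor. -/
def scalOf (γ : Matrix Idx Idx ℝ) (R : Idx → Idx → Idx → Idx → ℝ) : ℝ :=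
  ∑ a, ∑ b, γ⁻¹ a b * ricOf γ R a b

/-- The Weyl part of a curvature-type tensor. -/
def weylOf (γ : Matrix Idx Idx ℝ) (R : Idx → Idx → Idx → Idx → ℝ) (a b c d : Idx) : ℝ :=
  R a b c d
    - (1 / 2) * (ricOf γ R a c * γ b d - ricOf γ R a d * γ b c
      + ricOf γ R b d * γ a c - ricOf γ R b c * γ a d)
    + scalOf γ R / 6 * (γ a c * γ b d - γ a d * γ b c)

/-- The block diagonal metric `-N² dt² + g`. -/
def blockMet (N : ℝ) (g : Matrix (Fin 3) (Fin 3) ℝ) : Matrix Idx Idx ℝ :=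
  Matrix.fromBlocks (Matrix.of fun _ _ => -N ^ 2) 0 0 g

/-- The block diagonal metric `N² dt² + g`. -/
def blockRiem (N : ℝ) (g : Matrix (Fin 3) (Fin 3) ℝ) : Matrix Idx Idx ℝ :=
  Matrix.fromBlocks (Matrix.of fun _ _ => N ^ 2) 0 0 g

lemma blockMet_inv {N : ℝ} {g : Matrix (Fin 3) (Fin 3) ℝ} (hN : N ≠ 0) (hg : IsUnit g.det) :
    (blockMet N g)⁻¹ = Matrix.fromBlocks (Matrix.of fun _ _ => -(N⁻¹) ^ 2) 0 0 g⁻¹ := by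
  apply Matrix.inv_eq_right_inv
  rw [blockMet, Matrix.fromBlocks_multiply, Matrix.mul_nonsing_inv _ hg]
  simp only [Matrix.mul_zero, Matrix.zero_mul, add_zero, zero_add]
  rw [← Matrix.fromBlocks_one]
  congr 1
  ext i j
  simp [Matrix.mul_apply, hN]

lemma blockRiem_inv {N : ℝ} {g : Matrix (Fin 3) (Fin 3) ℝ} (hN : N ≠ 0) (hg : IsUnit g.det) :
    (blockRiem N g)⁻¹ = Matrix.fromBlocks (Matrix.of fun _ _ => (N⁻¹) ^ 2) 0 0 g⁻¹ := by
  apply Matrix.inv_eq_right_inv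
  rw [blockRiem, Matrix.fromBlocks_multiply, Matrix.mul_nonsing_inv _ hg]
  simp only [Matrix.mul_zero, Matrix.zero_mul, add_zero, zero_add]
  rw [← Matrix.fromBlocks_one]
  congr 1
  ext i j
  simp [Matrix.mul_apply, hN]

lemma trace_inv_mul {ι : Type*} [Fintype ι] [DecidableEq ι] {g : Matrix ι ι ℝ} (hg : g.PosDef) :
    ∑ l, ∑ j, g⁻¹ l j * g l j = Fintype.card ι := by
  have h : ∀ l, ∑ j, g⁻¹ l j * g l j = 1 := fun l => by
    have h := congrFun (congrFun (Matrix.nonsing_inv_mul g hg.det_pos.ne'.isUnit) l) l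
    rw [Matrix.mul_apply, Matrix.one_apply_eq] at h
    rw [← h]
    exact Finset.sum_congr rfl fun j _ => by rw [← hg.isHermitian.apply j l]; rfl
  simp [h]

/-- The curvature of a perfect fluid at a point, when the slices are umbilic with constant mean
curvature. -/
structure FluidPoint (N : ℝ) (g : Matrix (Fin 3) (Fin 3) ℝ) (R : Idx → Idx → Idx → Idx → ℝ)
    (μ P : ℝ) : Prop where
  N_pos : 0 < N
  posDef : g.PosDef
  antisymm_left : ∀ a b c d, R a b c d = -R b a c d
  antisymm_right : ∀ a b c d, R a b c d = -R a b d c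
  tsss : ∀ i j l, R (Sum.inl ()) (Sum.inr i) (Sum.inr j) (Sum.inr l) = 0
  ssts : ∀ i j l, R (Sum.inr i) (Sum.inr j) (Sum.inl ()) (Sum.inr l) = 0
  einstein : ∀ a b, ricOf (blockMet N g) R a b - (1 / 2) * scalOf (blockMet N g) R * blockMet N g a b
    = (Matrix.fromBlocks (Matrix.of fun _ _ => N ^ 2 * μ) 0 0 (P • g) : Matrix Idx Idx ℝ) a b

namespace FluidPoint

variable {N : ℝ} {g : Matrix (Fin 3) (Fin 3) ℝ} {R : Idx → Idx → Idx → Idx → ℝ} {μ P : ℝ}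

/-- The spatial trace of the spatial curvature. -/
def rho (g : Matrix (Fin 3) (Fin 3) ℝ) (R : Idx → Idx → Idx → Idx → ℝ) (l j : Fin 3) : ℝ :=
  ∑ k, ∑ i, g⁻¹ k i * R (Sum.inr k) (Sum.inr l) (Sum.inr i) (Sum.inr j)

lemma diag_left (h : FluidPoint N g R μ P) (a c d : Idx) : R a a c d = 0 := by
  have := h.antisymm_left a a c d; linarith

lemma diag_right (h : FluidPoint N g R μ P) (a b c : Idx) : R a b c c = 0 := by
  have := h.antisymm_right a b c c; linarith

lemma stst (h : FluidPoint N g R μ P) (i j : Fin 3) :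
    R (Sum.inr i) (Sum.inl ()) (Sum.inr j) (Sum.inl ())
      = R (Sum.inl ()) (Sum.inr i) (Sum.inl ()) (Sum.inr j) := by
  rw [h.antisymm_left, h.antisymm_right, neg_neg]

lemma stss (h : FluidPoint N g R μ P) (i j l : Fin 3) :
    R (Sum.inr i) (Sum.inl ()) (Sum.inr j) (Sum.inr l) = 0 := by
  rw [h.antisymm_left, h.tsss, neg_zero]

lemma ssst (h : FluidPoint N g R μ P) (i j l : Fin 3) :
    R (Sum.inr i) (Sum.inr j) (Sum.inr l) (Sum.inl ()) = 0 := by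
  rw [h.antisymm_right, h.ssts, neg_zero]

lemma inv (h : FluidPoint N g R μ P) : (blockMet N g)⁻¹
    = Matrix.fromBlocks (Matrix.of fun _ _ => -(N⁻¹) ^ 2) 0 0 g⁻¹ :=
  blockMet_inv h.N_pos.ne' h.posDef.det_pos.ne'.isUnit

lemma ric_ss (h : FluidPoint N g R μ P) (l j : Fin 3) :
    ricOf (blockMet N g) R (Sum.inr l) (Sum.inr j)
      = -(N⁻¹) ^ 2 * R (Sum.inl ()) (Sum.inr l) (Sum.inl ()) (Sum.inr j) + rho g R l j := by
  simp [ricOf, h.inv, rho]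

lemma ric_tt (h : FluidPoint N g R μ P) : ricOf (blockMet N g) R (Sum.inl ()) (Sum.inl ())
      = ∑ i, ∑ k, g⁻¹ i k * R (Sum.inl ()) (Sum.inr i) (Sum.inl ()) (Sum.inr k) := by
  simp [ricOf, h.inv, h.diag_left, h.stst]

lemma ric_ts (h : FluidPoint N g R μ P) (j : Fin 3) :
    ricOf (blockMet N g) R (Sum.inl ()) (Sum.inr j) = 0 := by
  simp [ricOf, h.inv, h.diag_left, h.stss]

lemma ric_st (h : FluidPoint N g R μ P) (j : Fin 3) :
    ricOf (blockMet N g) R (Sum.inr j) (Sum.inl ()) = 0 := by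
  simp [ricOf, h.inv, h.diag_right, h.ssst]

lemma scal_eq (h : FluidPoint N g R μ P) : scalOf (blockMet N g) R
    = -(N⁻¹) ^ 2 * ricOf (blockMet N g) R (Sum.inl ()) (Sum.inl ())
      + ∑ l, ∑ j, g⁻¹ l j * ricOf (blockMet N g) R (Sum.inr l) (Sum.inr j) := by
  simp [scalOf, h.inv]

lemma ric_tt_eq (h : FluidPoint N g R μ P) : ricOf (blockMet N g) R (Sum.inl ()) (Sum.inl ())
    = N ^ 2 * (μ - scalOf (blockMet N g) R / 2) := by
  have := h.einstein (Sum.inl ()) (Sum.inl ())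
  simp [blockMet] at this ⊢
  linarith

lemma ric_ss_eq (h : FluidPoint N g R μ P) (l j : Fin 3) :
    ricOf (blockMet N g) R (Sum.inr l) (Sum.inr j)
      = (P + scalOf (blockMet N g) R / 2) * g l j := by
  have := h.einstein (Sum.inr l) (Sum.inr j)
  simp [blockMet] at this ⊢
  linarith

lemma trace_g (h : FluidPoint N g R μ P) (c : ℝ) : ∑ l, ∑ j, g⁻¹ l j * (c * g l j) = 3 * c := by
  have := trace_inv_mul h.posDef
  rw [Fintype.card_fin, Nat.cast_ofNat] at this
  rw [← this]
  simp only [Finset.sum_mul]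
  exact Finset.sum_congr rfl fun _ _ => Finset.sum_congr rfl fun _ _ => by ring

/-- Trace of the Einstein equation: in dimension four, R = -tr 𝒯. -/
lemma scal_val (h : FluidPoint N g R μ P) : scalOf (blockMet N g) R = μ - 3 * P := by
  have h1 := h.scal_eq
  have hN : (N⁻¹) ^ 2 * N ^ 2 = 1 := by rw [← mul_pow, inv_mul_cancel₀ h.N_pos.ne', one_pow]
  simp only [h.ric_tt_eq, h.ric_ss_eq, h.trace_g] at h1
  linear_combination -h1 + (μ - scalOf (blockMet N g) R / 2) * hN

/-- The spatial Ricci components are pure trace, which ties R_{TlTj} to the spatial contraction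
`rho`. -/
lemma tsts (h : FluidPoint N g R μ P) (l j : Fin 3) :
    R (Sum.inl ()) (Sum.inr l) (Sum.inl ()) (Sum.inr j)
      = N ^ 2 * (rho g R l j - (μ - P) / 2 * g l j) := by
  have h1 := h.ric_ss l j
  have hN : N ^ 2 * (N⁻¹) ^ 2 = 1 := by rw [← mul_pow, mul_inv_cancel₀ h.N_pos.ne', one_pow]
  rw [h.ric_ss_eq, h.scal_val] at h1
  linear_combination N ^ 2 * h1 - R (Sum.inl ()) (Sum.inr l) (Sum.inl ()) (Sum.inr j) * hN

/-- Compare the trace of `tsts` with the time-time Einstein equation. -/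
lemma trace_rho (h : FluidPoint N g R μ P) : ∑ l, ∑ j, g⁻¹ l j * rho g R l j = 2 * μ := by
  have h1 := h.ric_tt
  have h2 : ∑ l, ∑ j, g⁻¹ l j * (N ^ 2 * (rho g R l j - (μ - P) / 2 * g l j))
      = N ^ 2 * (∑ l, ∑ j, g⁻¹ l j * rho g R l j
        - ∑ l, ∑ j, g⁻¹ l j * ((μ - P) / 2 * g l j)) := by
    simp only [Finset.mul_sum, ← Finset.sum_sub_distrib]
    exact Finset.sum_congr rfl fun _ _ => Finset.sum_congr rfl fun _ _ => by ring
  simp only [h.tsts] at h1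
  rw [h2, h.trace_g, h.ric_tt_eq, h.scal_val] at h1
  have h3 := mul_left_cancel₀ (pow_ne_zero 2 h.N_pos.ne') h1
  linarith

/-- The trace-free part of the spatial Ricci contraction. -/
def tf (g : Matrix (Fin 3) (Fin 3) ℝ) (R : Idx → Idx → Idx → Idx → ℝ) (μ : ℝ) (l j : Fin 3) : ℝ :=
  rho g R l j - 2 * μ / 3 * g l j

/-- Identifies `tf` with the electric part E of the Weyl tensor: the Ricci corrections are multiples
of g. -/
lemma weyl_tsts (h : FluidPoint N g R μ P) (l j : Fin 3) :
    weylOf (blockMet N g) R (Sum.inl ()) (Sum.inr l) (Sum.inl ()) (Sum.inr j)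
      = N ^ 2 * tf g R μ l j := by
  rw [weylOf, h.ric_tt_eq, h.ric_ss_eq, h.ric_ts, h.ric_st, h.scal_val, h.tsts]
  simp [blockMet, tf]
  ring

lemma weyl_tsss (h : FluidPoint N g R μ P) (i j l : Fin 3) :
    weylOf (blockMet N g) R (Sum.inl ()) (Sum.inr i) (Sum.inr j) (Sum.inr l) = 0 := by
  simp only [weylOf, h.ric_ts, h.tsss]
  simp [blockMet]

lemma weyl_ssts (h : FluidPoint N g R μ P) (i j l : Fin 3) :
    weylOf (blockMet N g) R (Sum.inr i) (Sum.inr j) (Sum.inl ()) (Sum.inr l) = 0 := by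
  simp only [weylOf, h.ric_st, h.ssts]
  simp [blockMet]

lemma weyl_ssss (h : FluidPoint N g R μ P) (k l i j : Fin 3) :
    weylOf (blockMet N g) R (Sum.inr k) (Sum.inr l) (Sum.inr i) (Sum.inr j)
      = R (Sum.inr k) (Sum.inr l) (Sum.inr i) (Sum.inr j)
        - μ / 3 * (g k i * g l j - g k j * g l i) := by
  simp only [weylOf, h.ric_ss_eq, h.scal_val]
  simp only [blockMet, Matrix.fromBlocks_apply₂₂]
  ring

end FluidPoint

lemma weylOf_antisymm_left {γ : Matrix Idx Idx ℝ} {R : Idx → Idx → Idx → Idx → ℝ}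
    (h : ∀ a b c d, R a b c d = -R b a c d) (a b c d : Idx) :
    weylOf γ R a b c d = -weylOf γ R b a c d := by
  rw [weylOf, weylOf, h]; ring

lemma weylOf_antisymm_right {γ : Matrix Idx Idx ℝ} {R : Idx → Idx → Idx → Idx → ℝ}
    (h : ∀ a b c d, R a b c d = -R a b d c) (a b c d : Idx) :
    weylOf γ R a b c d = -weylOf γ R a b d c := by
  rw [weylOf, weylOf, h]; ring

end FluidPoint

/-! ### Norms of tensors with only electric and purely spatial blocks -/

section Norms

open scoped Matrix

/-- A tensor with the symmetries and the block structure of a purely electric curvature tensor. -/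
structure BlockTensor (T : Idx → Idx → Idx → Idx → ℝ) : Prop where
  antisymm_left : ∀ a b c d, T a b c d = -T b a c d
  antisymm_right : ∀ a b c d, T a b c d = -T a b d c
  tsss : ∀ i j l, T (Sum.inl ()) (Sum.inr i) (Sum.inr j) (Sum.inr l) = 0
  ssts : ∀ i j l, T (Sum.inr i) (Sum.inr j) (Sum.inl ()) (Sum.inr l) = 0

/-- The block diagonal frame. -/
def blockFrame (N : ℝ) (A : Matrix (Fin 3) (Fin 3) ℝ) : Matrix Idx Idx ℝ :=
  Matrix.fromBlocks (Matrix.of fun _ _ => N⁻¹) 0 0 A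

lemma frame4_antisymm_left {ι : Type*} [Fintype ι] {A : Matrix ι ι ℝ} {T : ι → ι → ι → ι → ℝ}
    (h : ∀ a b c d, T a b c d = -T b a c d) (m n r s : ι) :
    frame4 A T m n r s = -frame4 A T n m r s := by
  simp only [frame4, Finset.mul_sum, ← Finset.sum_neg_distrib]
  rw [Finset.sum_comm]
  refine Finset.sum_congr rfl fun a _ => Finset.sum_congr rfl fun b _ => Finset.sum_congr rfl
    fun c _ => Finset.sum_congr rfl fun d _ => ?_
  rw [h]
  ring

lemma frame4_antisymm_right {ι : Type*} [Fintype ι] {A : Matrix ι ι ℝ} {T : ι → ι → ι → ι → ℝ}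
    (h : ∀ a b c d, T a b c d = -T a b d c) (m n r s : ι) :
    frame4 A T m n r s = -frame4 A T m n s r := by
  simp only [frame4, Finset.mul_sum, ← Finset.sum_neg_distrib]
  refine Finset.sum_congr rfl fun a _ => Finset.sum_congr rfl fun b _ => ?_
  rw [Finset.sum_comm]
  refine Finset.sum_congr rfl fun c _ => Finset.sum_congr rfl fun d _ => ?_
  rw [h]
  ring

namespace BlockTensor

variable {T : Idx → Idx → Idx → Idx → ℝ}

lemma frame (h : BlockTensor T) (N : ℝ) (A : Matrix (Fin 3) (Fin 3) ℝ) :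
    BlockTensor (frame4 (blockFrame N A) T) where
  antisymm_left := frame4_antisymm_left h.antisymm_left
  antisymm_right := frame4_antisymm_right h.antisymm_right
  tsss i j l := by simp [frame4, blockFrame, h.tsss]
  ssts i j l := by simp [frame4, blockFrame, h.ssts]

lemma frame_tsts (N : ℝ) (A : Matrix (Fin 3) (Fin 3) ℝ) (m n : Fin 3) :
    frame4 (blockFrame N A) T (Sum.inl ()) (Sum.inr m) (Sum.inl ()) (Sum.inr n)
      = frame2 A (fun i j => (N⁻¹) ^ 2 * T (Sum.inl ()) (Sum.inr i) (Sum.inl ()) (Sum.inr j))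
        m n := by
  simp only [frame4, blockFrame, frame2, Fintype.sum_sum_type, Finset.univ_unique,
    Finset.sum_singleton, Matrix.fromBlocks_apply₁₁, Matrix.fromBlocks_apply₂₁,
    Matrix.fromBlocks_apply₁₂, Matrix.fromBlocks_apply₂₂, Matrix.zero_apply, zero_mul,
    Finset.sum_const_zero, add_zero, zero_add, Matrix.of_apply, PUnit.default_eq_unit,
    Finset.mul_sum]
  exact Finset.sum_congr rfl fun _ _ => Finset.sum_congr rfl fun _ _ => by ring

lemma frame_ssss (N : ℝ) (A : Matrix (Fin 3) (Fin 3) ℝ) (k l i j : Fin 3) :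
    frame4 (blockFrame N A) T (Sum.inr k) (Sum.inr l) (Sum.inr i) (Sum.inr j)
      = frame4 A (fun k l i j => T (Sum.inr k) (Sum.inr l) (Sum.inr i) (Sum.inr j)) k l i j := by
  simp [frame4, blockFrame]

/-- The electric block occurs four times, according to the position of the time index in each
antisymmetric pair. -/
lemma sum_sq (h : BlockTensor T) : ∑ a, ∑ b, ∑ c, ∑ d, T a b c d ^ 2
    = 4 * (∑ i, ∑ j, T (Sum.inl ()) (Sum.inr i) (Sum.inl ()) (Sum.inr j) ^ 2)
      + ∑ k, ∑ l, ∑ i, ∑ j, T (Sum.inr k) (Sum.inr l) (Sum.inr i) (Sum.inr j) ^ 2 := by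
  have d1 : ∀ a c d, T a a c d = 0 := fun a c d => by
    have := h.antisymm_left a a c d; linarith
  have d2 : ∀ a b c, T a b c c = 0 := fun a b c => by
    have := h.antisymm_right a b c c; linarith
  have e1 : ∀ i j, T (Sum.inr i) (Sum.inl ()) (Sum.inr j) (Sum.inl ())
      = T (Sum.inl ()) (Sum.inr i) (Sum.inl ()) (Sum.inr j) := fun i j => by
    rw [h.antisymm_left, h.antisymm_right, neg_neg]
  have e2 : ∀ i j, T (Sum.inr i) (Sum.inl ()) (Sum.inl ()) (Sum.inr j)
      = -T (Sum.inl ()) (Sum.inr i) (Sum.inl ()) (Sum.inr j) := fun i j => h.antisymm_left _ _ _ _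
  have e3 : ∀ i j, T (Sum.inl ()) (Sum.inr i) (Sum.inr j) (Sum.inl ())
      = -T (Sum.inl ()) (Sum.inr i) (Sum.inl ()) (Sum.inr j) := fun i j => h.antisymm_right _ _ _ _
  have e4 : ∀ i j l, T (Sum.inr i) (Sum.inl ()) (Sum.inr j) (Sum.inr l) = 0 := fun i j l => by
    rw [h.antisymm_left, h.tsss, neg_zero]
  have e5 : ∀ i j l, T (Sum.inr i) (Sum.inr j) (Sum.inr l) (Sum.inl ()) = 0 := fun i j l => by
    rw [h.antisymm_right, h.ssts, neg_zero]
  simp only [Fintype.sum_sum_type, Finset.univ_unique, Finset.sum_singleton,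
    PUnit.default_eq_unit, d1, d2, e1, e2, e3, e4, e5, h.tsss, h.ssts, Finset.sum_add_distrib,
    neg_sq, ne_eq, OfNat.ofNat_ne_zero, not_false_eq_true, zero_pow, Finset.sum_const_zero]
  ring

end BlockTensor

/-- A curvature tensor in dimension three, in an orthonormal frame, is determined by its trace. -/
lemma sum_sq_curvature (K : Fin 3 → Fin 3 → Fin 3 → Fin 3 → ℝ)
    (h1 : ∀ k l i j, K k l i j = -K l k i j) (h2 : ∀ k l i j, K k l i j = -K k l j i)
    (r : ℝ) (hr : ∑ l, ∑ k, K k l k l = r) (c : ℝ) :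
    ∑ k, ∑ l, ∑ i, ∑ j, (K k l i j - c * ((if k = i then 1 else 0) * (if l = j then 1 else 0)
        - (if k = j then 1 else 0) * (if l = i then 1 else 0))) ^ 2
      = 4 * (∑ l, ∑ j, ((∑ k, K k l k j) - r / 3 * (if l = j then 1 else 0)) ^ 2)
        + 12 * (r / 6 - c) ^ 2 := by
  -- By Hodge duality K is a 3 × 3 matrix M, not necessarily symmetric, with trace r/2 and Ricci
  -- contraction (tr M) 1 - M up to transposition. The left side is 4|M - c·1|², which splits into
  -- its trace-free and trace parts.
  have d1 : ∀ a c d, K a a c d = 0 := fun a c d => by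
    have := h1 a a c d; linarith
  have d2 : ∀ a b c, K a b c c = 0 := fun a b c => by
    have := h2 a b c c; linarith
  subst hr
  simp only [Fin.sum_univ_three, d1, d2, Fin.isValue, h1 1 0, h1 2 0, h1 2 1, h2 _ _ 1 0,
    h2 _ _ 2 0, h2 _ _ 2 1]
  simp
  ring

end Norms

/-! ### The norms of the Riemann and Weyl tensors of a perfect fluid -/

section FluidNorms

open scoped Matrix

section

variable {ι : Type*} [Fintype ι] {A : Matrix ι ι ℝ}

lemma sum_mul_contract {gi : Matrix ι ι ℝ} (hg : gi = A * Aᵀ) (f : ι → ι → ℝ) :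
    ∑ a, ∑ c, gi a c * f a c = ∑ m, ∑ a, A a m * ∑ c, A c m * f a c := by
  simp only [hg, Matrix.mul_apply, Matrix.transpose_apply, Finset.sum_mul, Finset.mul_sum]
  conv_rhs => rw [Finset.sum_comm]
  refine Finset.sum_congr rfl fun a _ => ?_
  rw [Finset.sum_comm]
  exact Finset.sum_congr rfl fun m _ => Finset.sum_congr rfl fun c _ => by ring

lemma trace_frame2 {gi : Matrix ι ι ℝ} (hg : gi = A * Aᵀ) (X : ι → ι → ℝ) :
    ∑ m, frame2 A X m m = ∑ a, ∑ c, gi a c * X a c := (sum_mul_contract hg X).symm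

lemma trace_frame4 {gi : Matrix ι ι ℝ} (hg : gi = A * Aᵀ) (K : ι → ι → ι → ι → ℝ) (l j : ι) :
    ∑ m, frame4 A K m l m j = frame2 A (fun b d => ∑ a, ∑ c, gi a c * K a b c d) l j := by
  simp only [sum_mul_contract hg, frame4, frame2, Finset.mul_sum]
  conv_rhs =>
    enter [2, b]
    rw [Finset.sum_comm]
  conv_rhs => rw [Finset.sum_comm]
  refine Finset.sum_congr rfl fun m _ => ?_
  conv_rhs =>
    enter [2, b]
    rw [Finset.sum_comm]
  conv_rhs => rw [Finset.sum_comm]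
  refine Finset.sum_congr rfl fun a _ => Finset.sum_congr rfl fun b _ => ?_
  conv_rhs => rw [Finset.sum_comm]
  exact Finset.sum_congr rfl fun c _ => Finset.sum_congr rfl fun d _ => by ring

lemma frame2_metric [DecidableEq ι] {g : Matrix ι ι ℝ} (h : Aᵀ * g * A = 1) (m n : ι) :
    frame2 A g m n = if m = n then 1 else 0 := by
  rw [← Matrix.one_apply, ← h, mul_assoc]
  simp only [Matrix.mul_apply, frame2, Matrix.transpose_apply]
  refine Finset.sum_congr rfl fun a _ => ?_
  congr 1
  exact Finset.sum_congr rfl fun b _ => mul_comm _ _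

lemma frame2_add (X Y : ι → ι → ℝ) (c : ℝ) (m n : ι) :
    frame2 A (fun i j => X i j + c * Y i j) m n = frame2 A X m n + c * frame2 A Y m n := by
  simp only [frame2, Finset.mul_sum, ← Finset.sum_add_distrib]
  exact Finset.sum_congr rfl fun _ _ => Finset.sum_congr rfl fun _ _ => by ring

lemma frame4_metric (X Y : ι → ι → ℝ) (k l i j : ι) :
    frame4 A (fun k l i j => X k i * Y l j) k l i j = frame2 A X k i * frame2 A Y l j := by
  rw [frame2, frame2, Finset.sum_mul_sum, frame4]
  simp only [Finset.mul_sum, Finset.sum_mul]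
  refine Finset.sum_congr rfl fun a _ => Finset.sum_congr rfl fun b _ => ?_
  rw [Finset.sum_comm]
  exact Finset.sum_congr rfl fun _ _ => Finset.sum_congr rfl fun _ _ => by ring

lemma frame4_metric' (X Y : ι → ι → ℝ) (k l i j : ι) :
    frame4 A (fun k l i j => X k j * Y l i) k l i j = frame2 A X k j * frame2 A Y l i := by
  rw [← frame4_metric]
  simp only [frame4, Finset.mul_sum]
  refine Finset.sum_congr rfl fun a _ => Finset.sum_congr rfl fun b _ => ?_
  rw [Finset.sum_comm]
  exact Finset.sum_congr rfl fun _ _ => Finset.sum_congr rfl fun _ _ => by ring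

lemma frame4_sub (K P Q : ι → ι → ι → ι → ℝ) (c : ℝ) (k l i j : ι) :
    frame4 A (fun k l i j => K k l i j - c * (P k l i j - Q k l i j)) k l i j
      = frame4 A K k l i j - c * (frame4 A P k l i j - frame4 A Q k l i j) := by
  simp only [frame4, Finset.mul_sum, ← Finset.sum_sub_distrib]
  exact Finset.sum_congr rfl fun _ _ => Finset.sum_congr rfl fun _ _ => Finset.sum_congr rfl
    fun _ _ => Finset.sum_congr rfl fun _ _ => by ring

end

lemma blockRiem_inv_frame {N : ℝ} {g A : Matrix (Fin 3) (Fin 3) ℝ} (hN : N ≠ 0)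
    (hg : g.PosDef) (hA : g⁻¹ = A * Aᵀ) :
    (blockRiem N g)⁻¹ = blockFrame N A * (blockFrame N A)ᵀ := by
  rw [blockRiem_inv hN hg.det_pos.ne'.isUnit, blockFrame, Matrix.fromBlocks_transpose,
    Matrix.fromBlocks_multiply, ← hA]
  simp only [Matrix.transpose_zero, Matrix.mul_zero, Matrix.zero_mul, add_zero, zero_add]
  congr 1
  ext i j
  simp [Matrix.mul_apply, pow_two]

namespace FluidPoint

variable {N : ℝ} {g : Matrix (Fin 3) (Fin 3) ℝ} {R : Idx → Idx → Idx → Idx → ℝ} {μ P : ℝ}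

/-- Treats Riemann and Weyl together, as they differ only in the pure-trace constants b and c. The
electric block contributes 4|E + b g|² = 4|E|² + 12b², because tr E = 0. The spatial block
contributes 4|E|² + 12(μ/3 - c)² by `sum_sq_curvature` with r = 2μ. -/
lemma norm4_eq (h : FluidPoint N g R μ P) {T : Idx → Idx → Idx → Idx → ℝ} (hT : BlockTensor T)
    (b c : ℝ)
    (h1 : ∀ l j, T (Sum.inl ()) (Sum.inr l) (Sum.inl ()) (Sum.inr j)
      = N ^ 2 * (tf g R μ l j + b * g l j))
    (h2 : ∀ k l i j, T (Sum.inr k) (Sum.inr l) (Sum.inr i) (Sum.inr j)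
      = R (Sum.inr k) (Sum.inr l) (Sum.inr i) (Sum.inr j) - c * (g k i * g l j - g k j * g l i)) :
    norm4 (blockRiem N g) T
      = Real.sqrt (8 * normSq2 g⁻¹ (tf g R μ) + 12 * b ^ 2 + 12 * (μ / 3 - c) ^ 2) := by
  obtain ⟨A, -, hA, hA1⟩ := exists_frame h.posDef
  rw [norm4_eq_frame (blockRiem_inv_frame h.N_pos.ne' h.posDef hA) T, (hT.frame N A).sum_sq,
    normSq2_eq_frame hA]
  refine congrArg Real.sqrt ?_
  have hN : (N⁻¹) ^ 2 * N ^ 2 = 1 := by rw [← mul_pow, inv_mul_cancel₀ h.N_pos.ne', one_pow]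
  have e1 : ∀ m n, frame4 (blockFrame N A) T (Sum.inl ()) (Sum.inr m) (Sum.inl ()) (Sum.inr n)
      = frame2 A (tf g R μ) m n + b * (if m = n then 1 else 0) := fun m n => by
    have := frame2_add (A := A) (tf g R μ) g b m n
    rw [BlockTensor.frame_tsts, ← frame2_metric hA1]
    simp only [h1, ← mul_assoc, hN, one_mul]
    exact this
  set K : Fin 3 → Fin 3 → Fin 3 → Fin 3 → ℝ :=
    fun k l i j => R (Sum.inr k) (Sum.inr l) (Sum.inr i) (Sum.inr j) with hK
  have e2 : ∀ k l i j, frame4 (blockFrame N A) T (Sum.inr k) (Sum.inr l) (Sum.inr i) (Sum.inr j)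
      = frame4 A K k l i j - c * ((if k = i then 1 else 0) * (if l = j then 1 else 0)
        - (if k = j then 1 else 0) * (if l = i then 1 else 0)) := fun k l i j => by
    rw [BlockTensor.frame_ssss]
    simp only [h2]
    rw [frame4_sub, frame4_metric (A := A) g g, frame4_metric' (A := A) g g]
    simp only [frame2_metric hA1]
    rfl
  have e3 : ∀ l j, frame2 A (tf g R μ) l j
      = (∑ k, frame4 A K k l k j) - 2 * μ / 3 * (if l = j then 1 else 0) := fun l j => by
    have := frame2_add (A := A) (rho g R) g (-(2 * μ / 3)) l j
    rw [frame2_metric hA1] at this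
    rw [trace_frame4 hA, sub_eq_add_neg, ← neg_mul]
    refine Eq.trans ?_ this
    refine congrArg (fun X => frame2 A X l j) (funext fun i => funext fun j => ?_)
    simp only [tf]
    ring
  have hr : ∑ l, ∑ k, frame4 A K k l k l = 2 * μ := by
    rw [← h.trace_rho, ← trace_frame2 hA]
    exact Finset.sum_congr rfl fun l _ => trace_frame4 hA K l l
  have e4 := sum_sq_curvature (frame4 A K) (frame4_antisymm_left fun _ _ _ _ => h.antisymm_left _ _ _ _)
    (frame4_antisymm_right fun _ _ _ _ => h.antisymm_right _ _ _ _) (2 * μ) hr c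
  have e5 : ∑ m, frame2 A (tf g R μ) m m = 0 := by
    simp only [e3, Finset.sum_sub_distrib, hr]
    simp
    ring
  simp only [e2, e4, e1, ← e3]
  simp only [Fin.sum_univ_three, Fin.isValue] at e5 ⊢
  simp
  linear_combination 8 * b * e5

lemma blockTensor (h : FluidPoint N g R μ P) : BlockTensor R :=
  ⟨h.antisymm_left, h.antisymm_right, h.tsss, h.ssts⟩

lemma norm4_riemann (h : FluidPoint N g R μ P) : norm4 (blockRiem N g) R
    = Real.sqrt (8 * normSq2 g⁻¹ (tf g R μ) + 12 * (μ / 6 + P / 2) ^ 2 + 12 * (μ / 3) ^ 2) := by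
  rw [h.norm4_eq h.blockTensor (μ / 6 + P / 2) 0 (fun l j => ?_) (fun k l i j => ?_), sub_zero]
  · rw [h.tsts, tf]; ring
  · ring

lemma norm4_weyl (h : FluidPoint N g R μ P) :
    norm4 (blockRiem N g) (weylOf (blockMet N g) R)
      = Real.sqrt (8 * normSq2 g⁻¹ (tf g R μ)) := by
  rw [h.norm4_eq ⟨weylOf_antisymm_left h.antisymm_left, weylOf_antisymm_right h.antisymm_right,
    h.weyl_tsss, h.weyl_ssts⟩ 0 (μ / 3) (fun l j => ?_) h.weyl_ssss]
  · simp
  · rw [h.weyl_tsts]; ring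

lemma riemann_eq_zero (h : FluidPoint N g R μ P) (h0 : norm4 (blockRiem N g) R = 0)
    (a b c d : Idx) : R a b c d = 0 := by
  obtain ⟨A, hdet, hA, -⟩ := exists_frame h.posDef
  have hdet' : IsUnit (blockFrame N A).det := by
    rw [blockFrame, Matrix.det_fromBlocks_zero₂₁]
    refine IsUnit.mul ?_ hdet
    simp [h.N_pos.ne']
  refine eq_zero_of_frame4 hdet' (fun m n r s => ?_) a b c d
  rw [norm4_eq_frame (blockRiem_inv_frame h.N_pos.ne' h.posDef hA) R,
    Real.sqrt_eq_zero (by positivity)] at h0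
  have h1 := (Finset.sum_eq_zero_iff_of_nonneg (fun _ _ => by positivity)).1 h0 m (Finset.mem_univ _)
  have h2 := (Finset.sum_eq_zero_iff_of_nonneg (fun _ _ => by positivity)).1 h1 n (Finset.mem_univ _)
  have h3 := (Finset.sum_eq_zero_iff_of_nonneg (fun _ _ => by positivity)).1 h2 r (Finset.mem_univ _)
  have h4 := (Finset.sum_eq_zero_iff_of_nonneg (fun _ _ => by positivity)).1 h3 s (Finset.mem_univ _)
  exact pow_eq_zero_iff two_ne_zero |>.1 h4

end FluidPoint

end FluidNorms

/-! ### Perfect fluids in coordinates -/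

namespace CoordMetric

variable {I : Set ℝ} {U : Set E3} (C : CoordMetric I U)

/-- The Einstein equation of a perfect fluid in coordinates. -/
structure IsFluid (γ : ℝ → E3 → Matrix Idx Idx ℝ) (μ P : ℝ → E3 → ℝ) : Prop where
  metric : ∀ t ∈ I, ∀ y ∈ U, γ t y = C.γ t y
  einstein : ∀ t ∈ I, ∀ y ∈ U, ∀ a b, einstein I γ a b t y
    = (Matrix.fromBlocks (Matrix.of fun _ _ => C.n t y ^ 2 * μ t y) 0 0 (P t y • C.g t y) :
      Matrix Idx Idx ℝ) a b

/-- The components of the curvature tensor at a point. -/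
abbrev curv (I : Set ℝ) (γ : ℝ → E3 → Matrix Idx Idx ℝ) (t : ℝ) (y : E3) :
    Idx → Idx → Idx → Idx → ℝ := fun a b c d => riemann I γ a b c d t y

variable {C} {γ : ℝ → E3 → Matrix Idx Idx ℝ} {μ P : ℝ → E3 → ℝ}

lemma IsFluid.curv_eq (h : C.IsFluid γ μ P) (p : ↥(I ×ˢ U)) (a b c d : Idx) :
    curv I γ p.1.1 p.1.2 a b c d = ev p (C.data.R a b c d) := C.riemann_eq h.metric p a b c d

lemma IsFluid.antisymm_left (h : C.IsFluid γ μ P) (p : ↥(I ×ˢ U)) (a b c d : Idx) :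
    curv I γ p.1.1 p.1.2 a b c d = -curv I γ p.1.1 p.1.2 b a c d := by
  rw [h.curv_eq, h.curv_eq, ← map_neg, UmbilicData.R,
    riemLow_antisymm_left C.data.comm C.data.met_symm C.data.met_inv]

lemma IsFluid.antisymm_right (h : C.IsFluid γ μ P) (p : ↥(I ×ˢ U)) (a b c d : Idx) :
    curv I γ p.1.1 p.1.2 a b c d = -curv I γ p.1.1 p.1.2 a b d c := by
  rw [h.curv_eq, h.curv_eq, ← map_neg, UmbilicData.R, riemLow_antisymm_right]

lemma ev_contract (p : ↥(I ×ˢ U)) (f : Fin 3 → Fin 3 → smoothFun (I ×ˢ U)) :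
    ev p (∑ k, ∑ i, C.data.gi k i * f k i)
      = ∑ k, ∑ i, (C.g p.1.1 p.1.2)⁻¹ k i * ev p (f k i) := by
  simp only [map_sum, map_mul, ev_gi]

/-- The momentum constraint: the mean curvature is locally constant on the slices. -/
lemma IsFluid.deriv_θ (h : C.IsFluid γ μ P) (j : Fin 3) : C.data.D₃ j C.data.θ = 0 := by
  apply ev_ext
  intro p
  have hn := C.n_pos p.1.1 p.2.1 p.1.2 p.2.2
  have hg := C.g_posDef (t := p.1.1) p.2.2
  have hE := h.einstein p.1.1 p.2.1 p.1.2 p.2.2 (Sum.inl ()) (Sum.inr j)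
  change ricOf (γ p.1.1 p.1.2) (curv I γ p.1.1 p.1.2) (Sum.inl ()) (Sum.inr j) - 1 / 2 *
    scalOf (γ p.1.1 p.1.2) (curv I γ p.1.1 p.1.2) * γ p.1.1 p.1.2 (Sum.inl ()) (Sum.inr j) = _ at hE
  rw [h.metric p.1.1 p.2.1 p.1.2 p.2.2] at hE
  change ricOf (blockMet (C.n p.1.1 p.1.2) (C.g p.1.1 p.1.2)) _ _ _ - 1 / 2 * _ *
    blockMet (C.n p.1.1 p.1.2) (C.g p.1.1 p.1.2) _ _ = _ at hE
  have h0 : curv I γ p.1.1 p.1.2 (Sum.inl ()) (Sum.inl ()) (Sum.inl ()) (Sum.inr j) = 0 := by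
    have := h.antisymm_left p (Sum.inl ()) (Sum.inl ()) (Sum.inl ()) (Sum.inr j); linarith
  have h1 : ricOf (blockMet (C.n p.1.1 p.1.2) (C.g p.1.1 p.1.2)) (curv I γ p.1.1 p.1.2)
      (Sum.inl ()) (Sum.inr j) = ∑ k, ∑ i, (C.g p.1.1 p.1.2)⁻¹ k i *
        curv I γ p.1.1 p.1.2 (Sum.inr k) (Sum.inl ()) (Sum.inr i) (Sum.inr j) := by
    rw [ricOf, blockMet_inv hn.ne' hg.det_pos.ne'.isUnit]
    simp [h0]
  -- The traced Codazzi equation; the factor 2 is 3 - 1, from the two traces of g in dimension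
  -- three.
  have h2 : ∑ k, ∑ i, (C.g p.1.1 p.1.2)⁻¹ k i *
      curv I γ p.1.1 p.1.2 (Sum.inr k) (Sum.inl ()) (Sum.inr i) (Sum.inr j)
      = ev p (-(2 * C.data.N * C.data.D₃ j C.data.θ)) := by
    simp only [h.curv_eq]
    rw [← ev_contract]
    congr 1
    have e1 := C.data.sum_gi_mul_const_mul_g (C.data.D₃ j C.data.θ)
    have e2 := C.data.sum_gi_mul_mul_g (fun i => C.data.D₃ i C.data.θ) j
    calc _ = -(C.data.N * (∑ k, ∑ i, C.data.gi k i * (C.data.D₃ j C.data.θ * C.data.g k i)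
          - ∑ k, ∑ i, C.data.gi k i * (C.data.D₃ i C.data.θ * C.data.g j k))) := by
          simp only [Finset.mul_sum, ← Finset.sum_sub_distrib, ← Finset.sum_neg_distrib]
          refine Finset.sum_congr rfl fun k _ => Finset.sum_congr rfl fun i _ => ?_
          rw [UmbilicData.R_stss, C.data.symm.apply k i]
          ring
      _ = _ := by rw [e1, e2]; ring
  rw [h1, h2, map_neg, map_mul, map_mul, ev_N, map_ofNat] at hE
  simp only [blockMet, Matrix.fromBlocks_apply₁₂, Matrix.zero_apply, mul_zero, sub_zero,
    neg_eq_zero] at hE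
  rw [map_zero]
  exact (mul_eq_zero.1 hE).resolve_left (by positivity)

lemma IsFluid.point (h : C.IsFluid γ μ P) (p : ↥(I ×ˢ U)) :
    FluidPoint (C.n p.1.1 p.1.2) (C.g p.1.1 p.1.2) (curv I γ p.1.1 p.1.2)
      (μ p.1.1 p.1.2) (P p.1.1 p.1.2) where
  N_pos := C.n_pos p.1.1 p.2.1 p.1.2 p.2.2
  posDef := C.g_posDef p.2.2
  antisymm_left := h.antisymm_left p
  antisymm_right := h.antisymm_right p
  tsss i j l := by
    rw [h.curv_eq, UmbilicData.R_tsss, h.deriv_θ, h.deriv_θ]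
    simp
  ssts i j l := by
    rw [h.curv_eq, UmbilicData.R_ssts _ h.deriv_θ, map_zero]
  einstein a b := by
    have hE := h.einstein p.1.1 p.2.1 p.1.2 p.2.2 a b
    change ricOf (γ p.1.1 p.1.2) (curv I γ p.1.1 p.1.2) a b - 1 / 2 *
      scalOf (γ p.1.1 p.1.2) (curv I γ p.1.1 p.1.2) * γ p.1.1 p.1.2 a b = _ at hE
    rw [h.metric p.1.1 p.2.1 p.1.2 p.2.2] at hE
    exact hE

open FluidPoint

/-- Traced Gauss equation. -/
lemma IsFluid.rho_eq (h : C.IsFluid γ μ P) (p : ↥(I ×ˢ U)) (l j : Fin 3) :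
    rho (C.g p.1.1 p.1.2) (curv I γ p.1.1 p.1.2) l j
      = ev p (C.data.ric l j + 2 * C.data.θ ^ 2 * C.data.g l j) := by
  simp only [rho, h.curv_eq]
  rw [← ev_contract]
  congr 1
  have e1 := C.data.sum_gi_mul_const_mul_g (C.data.g l j)
  have e2 := C.data.sum_gi_mul_mul_g (fun i => C.data.g i l) j
  calc _ = C.data.ric l j + C.data.θ ^ 2 * (∑ k, ∑ i, C.data.gi k i *
          (C.data.g l j * C.data.g k i)
        - ∑ k, ∑ i, C.data.gi k i * (C.data.g i l * C.data.g j k)) := by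
        simp only [UmbilicData.ric, Finset.mul_sum, ← Finset.sum_sub_distrib,
          ← Finset.sum_add_distrib]
        refine Finset.sum_congr rfl fun k _ => Finset.sum_congr rfl fun i _ => ?_
        rw [UmbilicData.R_ssss, C.data.symm.apply k i, C.data.symm.apply l j]
        ring
    _ = _ := by rw [e1, e2, C.data.symm.apply l j]; ring

/-- Hamiltonian constraint: trace the Gauss equation once more. -/
lemma IsFluid.two_mul_μ (h : C.IsFluid γ μ P) (p : ↥(I ×ˢ U)) :
    2 * μ p.1.1 p.1.2 = ev p (C.data.scal + 6 * C.data.θ ^ 2) := by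
  rw [← (h.point p).trace_rho]
  simp only [h.rho_eq]
  rw [← ev_contract]
  congr 1
  have e1 := C.data.sum_gi_mul_const_mul_g (2 * C.data.θ ^ 2)
  simp only [mul_add, Finset.sum_add_distrib]
  rw [e1, ← UmbilicData.scal]
  ring

/-- Umbilic slices add only a multiple of g in the Gauss equation, so E is the trace-free intrinsic
Ricci tensor. -/
lemma IsFluid.tf_eq (h : C.IsFluid γ μ P) (p : ↥(I ×ˢ U)) (l j : Fin 3) :
    3 * tf (C.g p.1.1 p.1.2) (curv I γ p.1.1 p.1.2) (μ p.1.1 p.1.2) l j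
      = ev p (C.data.ricTF l j) := by
  have h1 := h.two_mul_μ p
  rw [tf, h.rho_eq, UmbilicData.ricTF]
  simp only [map_add, map_sub, map_mul, map_pow, map_ofNat, ev_g] at h1 ⊢
  linear_combination -C.g p.1.1 p.1.2 l j * h1

/-- Equate the two expressions for R_{TlTj}, one from the lapse and one from the Einstein equation.
-/
lemma IsFluid.hess_eq (h : C.IsFluid γ μ P) (p : ↥(I ×ˢ U)) (l j : Fin 3) :
    ev p (C.data.hess l j)
      = C.n p.1.1 p.1.2 * tf (C.g p.1.1 p.1.2) (curv I γ p.1.1 p.1.2) (μ p.1.1 p.1.2) l j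
      + (C.n p.1.1 p.1.2 * (μ p.1.1 p.1.2 / 6 + P p.1.1 p.1.2 / 2) + ev p (C.data.D₀ C.data.θ)
        + C.n p.1.1 p.1.2 * ev p C.data.θ ^ 2) * C.g p.1.1 p.1.2 l j := by
  have h1 := (h.point p).tsts l j
  rw [h.curv_eq, UmbilicData.R_tsts] at h1
  simp only [map_add, map_sub, map_mul, map_pow, ev_N, ev_g] at h1
  apply mul_left_cancel₀ (h.point p).N_pos.ne'
  rw [tf]
  linear_combination h1

lemma IsFluid.trace_tf (h : C.IsFluid γ μ P) (p : ↥(I ×ˢ U)) :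
    ∑ l, ∑ j, (C.g p.1.1 p.1.2)⁻¹ l j *
      tf (C.g p.1.1 p.1.2) (curv I γ p.1.1 p.1.2) (μ p.1.1 p.1.2) l j = 0 := by
  simp only [tf, mul_sub, Finset.sum_sub_distrib]
  rw [(h.point p).trace_rho, (h.point p).trace_g]
  ring

lemma IsFluid.lap_eq (h : C.IsFluid γ μ P) (p : ↥(I ×ˢ U)) :
    ev p C.data.lap = 3 * (C.n p.1.1 p.1.2 * (μ p.1.1 p.1.2 / 6 + P p.1.1 p.1.2 / 2)
        + ev p (C.data.D₀ C.data.θ) + C.n p.1.1 p.1.2 * ev p C.data.θ ^ 2) := by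
  rw [UmbilicData.lap, ev_contract]
  simp only [h.hess_eq]
  generalize C.n p.1.1 p.1.2 * (μ p.1.1 p.1.2 / 6 + P p.1.1 p.1.2 / 2)
    + ev p (C.data.D₀ C.data.θ) + C.n p.1.1 p.1.2 * ev p C.data.θ ^ 2 = c
  simp only [mul_add, Finset.sum_add_distrib]
  rw [(h.point p).trace_g]
  simp only [mul_left_comm _ (C.n p.1.1 p.1.2), ← Finset.mul_sum]
  rw [h.trace_tf]
  ring

/-- By `dt_ricTF` the rate is -θ times the trace-free Hessian of N, which is N E; and Nθ = σ_t. The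
evolution of E is thus an ordinary differential equation at each point of the slice. -/
lemma IsFluid.hasDerivWithinAt_tf (h : C.IsFluid γ μ P) {t : ℝ} {y : E3} (ht : t ∈ I) (hy : y ∈ U)
    (l j : Fin 3) : HasDerivWithinAt (fun t => tf (C.g t y) (curv I γ t y) (μ t y) l j)
      (-(C.s t y) * tf (C.g t y) (curv I γ t y) (μ t y) l j) I t := by
  have h1 := C.hasDerivWithinAt (C.data.ricTF l j)
    (f := fun t y => 3 * tf (C.g t y) (curv I γ t y) (μ t y) l j)
    (fun p => (h.tf_eq p l j).symm) ⟨(t, y), ht, hy⟩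
  have h2 := h1.const_mul (1 / 3)
  have e := C.data.dt_ricTF h.deriv_θ l j
  have hθ := C.ev_θ ⟨(t, y), ht, hy⟩
  have hh := h.hess_eq ⟨(t, y), ht, hy⟩ l j
  have hl := h.lap_eq ⟨(t, y), ht, hy⟩
  have hn := (C.n_pos t ht y hy).ne'
  simp only at hθ hh hl
  refine (h2.congr_deriv ?_).congr_of_mem (fun t _ => by ring) ht
  change 1 / 3 * ev _ (C.data.D₀ (C.data.ricTF l j)) = _
  rw [e, map_neg, map_mul, map_sub, map_mul, map_mul, map_ofNat, hh, hl, ev_g, hθ]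
  field_simp
  ring

/-- Energy conservation, obtained by differentiating the Hamiltonian constraint; the terms in ∂_t θ
from θ² and from the Laplacian of the lapse cancel. -/
lemma IsFluid.hasDerivWithinAt_μ (h : C.IsFluid γ μ P) {t : ℝ} {y : E3} (ht : t ∈ I)
    (hy : y ∈ U) : HasDerivWithinAt (fun t => μ t y) (-(3 * C.s t y * (μ t y + P t y))) I t := by
  have h1 := C.hasDerivWithinAt (C.data.scal + 6 * C.data.θ ^ 2)
    (f := fun t y => 2 * μ t y) (fun p => (h.two_mul_μ p).symm) ⟨(t, y), ht, hy⟩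
  have h2 := h1.const_mul (1 / 2)
  have h3 := h.two_mul_μ ⟨(t, y), ht, hy⟩
  have hθ := C.ev_θ ⟨(t, y), ht, hy⟩
  have hl := h.lap_eq ⟨(t, y), ht, hy⟩
  have hn := (C.n_pos t ht y hy).ne'
  have h6 : C.data.D₀ (6 : smoothFun (I ×ˢ U)) = 0 := by
    rw [show (6 : smoothFun (I ×ˢ U)) = algebraMap ℝ _ 6 from (map_ofNat _ 6).symm,
      Derivation.map_algebraMap]
  have e : C.data.D₀ (C.data.scal + 6 * C.data.θ ^ 2) = -(2 * (C.data.N * C.data.θ) * C.data.scal)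
      - 4 * (C.data.θ * C.data.lap) + 12 * C.data.θ * C.data.D₀ C.data.θ := by
    rw [map_add, C.data.dt_scal h.deriv_θ, pow_two]
    simp only [Derivation.leibniz, smul_eq_mul, h6]
    ring
  simp only at hθ hl h3
  refine (h2.congr_deriv ?_).congr_of_mem (fun t _ => by ring) ht
  change 1 / 2 * ev _ (C.data.D₀ (C.data.scal + 6 * C.data.θ ^ 2)) = _
  rw [e]
  simp only [map_add, map_neg, map_sub, map_mul, map_pow, map_ofNat, ev_N] at h3 ⊢
  rw [hl]
  rw [hθ] at h3 ⊢
  have hs : C.n t y * (C.s t y / C.n t y) = C.s t y := by field_simp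
  linear_combination (C.n t y * (C.s t y / C.n t y)) * h3 - 3 * (μ t y + P t y) * hs

end CoordMetric

/-! ### Monotonicity of the entropy along a line of constant position -/

section Evolution

variable {I : Set ℝ}

lemma monotoneOn_of_hasDerivWithinAt (hI : I.OrdConnected) {f f' : ℝ → ℝ}
    (hf : ∀ t ∈ I, HasDerivWithinAt f (f' t) I t) (h0 : ∀ t ∈ I, 0 ≤ f' t) : MonotoneOn f I :=
  monotoneOn_of_hasDerivWithinAt_nonneg hI.convex (fun t ht => (hf t ht).continuousWithinAt)
    (fun t ht => (hf t (interior_subset ht)).mono interior_subset)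
    (fun t ht => h0 t (interior_subset ht))

lemma eqOn_const_of_hasDerivWithinAt (hI : I.OrdConnected) {f : ℝ → ℝ}
    (hf : ∀ t ∈ I, HasDerivWithinAt f 0 I t) {t₁ t₂ : ℝ} (h1 : t₁ ∈ I) (h2 : t₂ ∈ I) :
    f t₁ = f t₂ := by
  have a := monotoneOn_of_hasDerivWithinAt hI hf (fun _ _ => le_rfl)
  have b := monotoneOn_of_hasDerivWithinAt hI (fun t ht => (hf t ht).neg) (fun _ _ => by simp)
  rcases le_total t₁ t₂ with h | h
  · exact le_antisymm (a h1 h2 h) (neg_le_neg_iff.1 (b h1 h2 h))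
  · exact le_antisymm (neg_le_neg_iff.1 (b h2 h1 h)) (a h2 h1 h)

/-- The evolution equations of the mass density and of the parameter along a line of constant
position. -/
structure FluidLine (I : Set ℝ) (σ s μ k κ : ℝ → ℝ) : Prop where
  ordConnected : I.OrdConnected
  hasDeriv_σ : ∀ t ∈ I, HasDerivWithinAt σ (s t) I t
  s_nonneg : ∀ t ∈ I, 0 ≤ s t
  k_mem : ∀ t ∈ I, k t ∈ Set.Icc (0 : ℝ) (4 / 3)
  -- Here s = σ_t, so -3s = N H; κ stands for k'.
  hasDeriv_μ : ∀ t ∈ I, HasDerivWithinAt μ (-(3 * s t * (k t * μ t))) I t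
  hasDeriv_k : ∀ t ∈ I, HasDerivWithinAt k (-(3 * s t * κ t)) I t
  κ_nonneg : ∀ t ∈ I, 0 ≤ κ t
  κ_le : ∀ t ∈ I, κ t * (3 * (4 - 3 * k t)) ≤ k t * (9 * k t ^ 2 - 12 * k t + 8)

namespace FluidLine

variable {σ s μ k κ : ℝ → ℝ}

/-- A zero propagates forwards because μ² is non-increasing, and backwards because μ² e^{8σ} is
non-decreasing. -/
lemma μ_eq_zero (h : FluidLine I σ s μ k κ) {t₀ t : ℝ} (h0 : t₀ ∈ I) (hμ : μ t₀ = 0)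
    (ht : t ∈ I) : μ t = 0 := by
  have a : MonotoneOn (fun t => -μ t ^ 2) I :=
    monotoneOn_of_hasDerivWithinAt h.ordConnected (fun t ht => ((h.hasDeriv_μ t ht).pow 2).neg)
      fun t ht => by
        have := h.s_nonneg t ht
        have := (h.k_mem t ht).1
        have : 0 ≤ s t * k t * μ t ^ 2 := by positivity
        norm_num
        nlinarith
  -- The logarithmic rate of μ² is -6kσ_t, and 8 = 6 · 4/3 compensates the largest possible k.
  have b : MonotoneOn (fun t => μ t ^ 2 * Real.exp (8 * σ t)) I :=
    monotoneOn_of_hasDerivWithinAt h.ordConnected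
      (fun t ht => ((h.hasDeriv_μ t ht).pow 2).mul (((h.hasDeriv_σ t ht).const_mul 8).exp))
      fun t ht => by
        have h1 := h.s_nonneg t ht
        have h2 : 0 ≤ 8 - 6 * k t := by linarith [(h.k_mem t ht).2]
        have : 0 ≤ s t * (8 - 6 * k t) * μ t ^ 2 * Real.exp (8 * σ t) := by positivity
        norm_num
        nlinarith
  have h2 : μ t ^ 2 ≤ 0 := by
    rcases le_total t₀ t with hle | hle
    · have := a h0 ht hle
      simp only [hμ] at this
      linarith
    · have := b ht h0 hle
      simp only [hμ] at this
      have he := Real.exp_pos (8 * σ t)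
      by_contra hc
      push Not at hc
      have := mul_pos hc he
      linarith
  exact pow_eq_zero_iff two_ne_zero |>.1 (le_antisymm h2 (sq_nonneg _))

/-- The squared norm of the curvature tensor. -/
def curvSq (c : ℝ) (σ μ k : ℝ → ℝ) (t : ℝ) : ℝ :=
  8 * (c * Real.exp (-(6 * σ t))) + μ t ^ 2 * (9 * k t ^ 2 - 12 * k t + 8) / 3

/-- The entropy along a line of constant position. -/
def entropy (c d : ℝ) (σ μ k : ℝ → ℝ) (t : ℝ) : ℝ :=
  (if curvSq c σ μ k t = 0 then 1
    else Real.sqrt (8 * (c * Real.exp (-(6 * σ t)))) / Real.sqrt (curvSq c σ μ k t))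
      * (Real.exp (3 * σ t) * d)

lemma hasDeriv_curvSq (h : FluidLine I σ s μ k κ) (c : ℝ) {t : ℝ} (ht : t ∈ I) :
    HasDerivWithinAt (curvSq c σ μ k) (-(s t * (48 * (c * Real.exp (-(6 * σ t)))
      + 2 * μ t ^ 2 * (k t * (9 * k t ^ 2 - 12 * k t + 8) + 3 * κ t * (3 * k t - 2))))) I t := by
  have h1 := ((((h.hasDeriv_σ t ht).const_mul 6).neg.exp).const_mul c).const_mul 8
  have hk := h.hasDeriv_k t ht
  have h2 := ((((hk.pow 2).const_mul 9).sub (hk.const_mul 12)).add_const 8)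
  have h3 := (((h.hasDeriv_μ t ht).pow 2).mul h2).div_const 3
  refine (h1.add h3).congr_deriv ?_
  simp
  ring

/-- The upper bound on k' gives k(9k² - 12k + 8) + 3κ(3k - 2) ≥ 3κ(4 - 3k) + 3κ(3k - 2) = 6κ ≥ 0. -/
lemma curvSq_rate_nonneg (h : FluidLine I σ s μ k κ) {c : ℝ} (hc : 0 ≤ c) {t : ℝ} (ht : t ∈ I) :
    0 ≤ s t * (48 * (c * Real.exp (-(6 * σ t)))
      + 2 * μ t ^ 2 * (k t * (9 * k t ^ 2 - 12 * k t + 8) + 3 * κ t * (3 * k t - 2))) := by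
  have h1 : 0 ≤ k t * (9 * k t ^ 2 - 12 * k t + 8) + 3 * κ t * (3 * k t - 2) := by
    nlinarith [h.κ_le t ht, h.κ_nonneg t ht]
  have := h.s_nonneg t ht
  positivity

lemma curvSq_eq_zero_iff {c : ℝ} (hc : 0 ≤ c) (t : ℝ) :
    curvSq c σ μ k t = 0 ↔ c = 0 ∧ μ t = 0 := by
  have hf : 0 < 9 * k t ^ 2 - 12 * k t + 8 := by nlinarith [sq_nonneg (3 * k t - 2)]
  have he := Real.exp_pos (-(6 * σ t))
  constructor
  · intro h0
    have h1 : 0 ≤ 8 * (c * Real.exp (-(6 * σ t))) := by positivity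
    have h2 : 0 ≤ μ t ^ 2 * (9 * k t ^ 2 - 12 * k t + 8) / 3 := by positivity
    rw [curvSq] at h0
    have h3 : c * Real.exp (-(6 * σ t)) = 0 := by linarith
    have h4 : μ t ^ 2 * (9 * k t ^ 2 - 12 * k t + 8) = 0 := by linarith
    exact ⟨(mul_eq_zero.1 h3).resolve_right he.ne',
      pow_eq_zero_iff two_ne_zero |>.1 ((mul_eq_zero.1 h4).resolve_right hf.ne')⟩
  · rintro ⟨rfl, h2⟩
    simp [curvSq, h2]

lemma curvSq_nonneg {c : ℝ} (hc : 0 ≤ c) (t : ℝ) : 0 ≤ curvSq c σ μ k t := by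
  have hf : 0 < 9 * k t ^ 2 - 12 * k t + 8 := by nlinarith [sq_nonneg (3 * k t - 2)]
  have he := Real.exp_pos (-(6 * σ t))
  rw [curvSq]
  positivity

/-- Expresses that |W| √g is constant in time. -/
lemma sqrt_mul_exp (c x : ℝ) :
    Real.sqrt (8 * (c * Real.exp (-(6 * x)))) * Real.exp (3 * x) = Real.sqrt (8 * c) := by
  rw [← mul_assoc, Real.sqrt_mul' _ (Real.exp_pos _).le,
    show Real.exp (-(6 * x)) = Real.exp (-(3 * x)) ^ 2 by rw [← Real.exp_nat_mul]; congr 1; push_cast; ring,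
    Real.sqrt_sq (Real.exp_pos _).le, mul_assoc, ← Real.exp_add, neg_add_cancel, Real.exp_zero,
    mul_one]

/-- The entropy is differentiable in time with non-negative derivative. -/
lemma exists_hasDeriv_entropy (h : FluidLine I σ s μ k κ) {c d : ℝ} (hc : 0 ≤ c) (hd : 0 ≤ d) :
    ∃ F' : ℝ → ℝ, ∀ t ∈ I, HasDerivWithinAt (entropy c d σ μ k) (F' t) I t ∧ 0 ≤ F' t := by
  -- The curvature vanishes at all times or at none, so the case distinction in the density never
  -- switches along the line and differentiability is not lost.
  by_cases h0 : ∃ t ∈ I, curvSq c σ μ k t = 0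
  · obtain ⟨t₀, ht₀, h0⟩ := h0
    obtain ⟨hc0, hμ⟩ := (curvSq_eq_zero_iff hc t₀).1 h0
    have hz : ∀ t ∈ I, entropy c d σ μ k t = Real.exp (3 * σ t) * d := fun t ht => by
      rw [entropy, if_pos ((curvSq_eq_zero_iff hc t).2 ⟨hc0, h.μ_eq_zero ht₀ hμ ht⟩), one_mul]
    refine ⟨fun t => Real.exp (3 * σ t) * (3 * s t) * d, fun t ht => ⟨?_, ?_⟩⟩
    · exact ((((h.hasDeriv_σ t ht).const_mul 3).exp).mul_const d).congr_of_mem hz ht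
    · have := h.s_nonneg t ht
      positivity
  · push Not at h0
    have hpos : ∀ t ∈ I, 0 < curvSq c σ μ k t := fun t ht =>
      lt_of_le_of_ne (curvSq_nonneg hc t) (h0 t ht).symm
    have hz : ∀ t ∈ I, entropy c d σ μ k t
        = Real.sqrt (8 * c) * d * (Real.sqrt (curvSq c σ μ k t))⁻¹ := fun t ht => by
      rw [entropy, if_neg (h0 t ht), ← sqrt_mul_exp c (σ t)]
      ring
    refine ⟨_, fun t ht => ⟨((((h.hasDeriv_curvSq c ht).sqrt (h0 t ht)).fun_inv
      (Real.sqrt_pos.2 (hpos t ht)).ne').const_mul (Real.sqrt (8 * c) * d)).congr_of_mem hz ht, ?_⟩⟩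
    have h1 := h.curvSq_rate_nonneg hc ht
    have h2 := hpos t ht
    simp only [neg_div, neg_neg]
    generalize s t * _ = r at h1 ⊢
    positivity

end FluidLine
end Evolution

/-! ### The entropy of a fluid along a line of constant position -/

namespace CoordMetric

open FluidPoint

variable {I : Set ℝ} {U : Set E3} {C : CoordMetric I U} {γ : ℝ → E3 → Matrix Idx Idx ℝ}
  {μ P : ℝ → E3 → ℝ}

/-- The squared norm of the trace-free Ricci tensor of the slices scales like `e^{-6σ}`. -/
lemma IsFluid.exists_normSq2 (h : C.IsFluid γ μ P) {y : E3} (hy : y ∈ U) :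
    ∃ c : ℝ, 0 ≤ c ∧ ∀ t ∈ I, normSq2 (C.g t y)⁻¹ (tf (C.g t y) (curv I γ t y) (μ t y))
      = c * Real.exp (-(6 * C.σ t y)) := by
  obtain ⟨t₀, ht₀⟩ := C.nontrivial.nonempty
  set B : ℝ → Fin 3 → Fin 3 → ℝ := fun t => tf (C.g t y) (curv I γ t y) (μ t y) with hB
  have hconst : ∀ t ∈ I, ∀ l j, B t l j
      = Real.exp (-C.σ t y) * (Real.exp (C.σ t₀ y) * B t₀ l j) := by
    intro t ht l j
    -- Since ∂_t E = -σ_t E, the tensor e^σ E is conserved.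
    have h1 : ∀ t ∈ I, HasDerivWithinAt (fun t => Real.exp (C.σ t y) * B t l j) 0 I t :=
      fun t ht => (((C.hasDerivWithinAt_σ ht hy).exp).mul
        (h.hasDerivWithinAt_tf ht hy l j)).congr_deriv (by ring)
    rw [← eqOn_const_of_hasDerivWithinAt C.ordConnected h1 ht ht₀, ← mul_assoc, ← Real.exp_add,
      neg_add_cancel, Real.exp_zero, one_mul]
  refine ⟨normSq2 (C.q y)⁻¹ fun l j => Real.exp (C.σ t₀ y) * B t₀ l j, ?_, fun t ht => ?_⟩
  · obtain ⟨A, -, hA, -⟩ := exists_frame (C.q_posDef y hy)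
    rw [normSq2_eq_frame hA]
    positivity
  · change normSq2 (C.g t y)⁻¹ (B t) = _
    -- Weight -2 from each of the two inverse metrics and -1 from each of the two factors E.
    have he : Real.exp (-(6 * C.σ t y)) = Real.exp (-(2 * C.σ t y)) * Real.exp (-(2 * C.σ t y))
        * (Real.exp (-C.σ t y) * Real.exp (-C.σ t y)) := by
      simp only [← Real.exp_add]
      congr 1
      ring
    rw [C.g_inv hy, he, normSq2, normSq2]
    simp only [hconst t ht, Matrix.smul_apply, smul_eq_mul, Finset.sum_mul]
    refine Finset.sum_congr rfl fun _ _ => Finset.sum_congr rfl fun _ _ => Finset.sum_congr rfl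
      fun _ _ => Finset.sum_congr rfl fun _ _ => by ring

open Classical in
/-- The entropy in coordinates, along a line of constant position. -/
lemma IsFluid.exists_entropy (h : C.IsFluid γ μ P) {y : E3} (hy : y ∈ U) {k : ℝ → ℝ}
    (hP : ∀ t ∈ I, P t y = (k t - 1) * μ t y) :
    ∃ c d : ℝ, 0 ≤ c ∧ 0 ≤ d ∧ ∀ t ∈ I,
      (if ∀ a b c d : Idx, riemann I γ a b c d t y = 0 then 1
        else norm4 (blockRiem (C.n t y) (C.g t y)) (fun a b c d => weyl I γ a b c d t y) /
          norm4 (blockRiem (C.n t y) (C.g t y)) (fun a b c d => riemann I γ a b c d t y))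
        * Real.sqrt (C.g t y).det
      = FluidLine.entropy c d (fun t => C.σ t y) (fun t => μ t y) k t := by
  obtain ⟨c, hc, hB⟩ := h.exists_normSq2 hy
  refine ⟨c, Real.sqrt (C.q y).det, hc, Real.sqrt_nonneg _, fun t ht => ?_⟩
  have hp := h.point ⟨(t, y), ht, hy⟩
  simp only at hp
  have hW : norm4 (blockRiem (C.n t y) (C.g t y)) (fun a b c d => weyl I γ a b c d t y)
      = Real.sqrt (8 * (c * Real.exp (-(6 * C.σ t y)))) := by
    rw [← hB t ht, ← hp.norm4_weyl]
    congr 1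
    ext a b c d
    change weylOf (γ t y) (curv I γ t y) a b c d = _
    rw [h.metric t ht y hy]
    rfl
  have hR : norm4 (blockRiem (C.n t y) (C.g t y)) (curv I γ t y)
      = Real.sqrt (FluidLine.curvSq c (fun t => C.σ t y) (fun t => μ t y) k t) := by
    rw [hp.norm4_riemann, hB t ht, hP t ht]
    congr 1
    simp only [FluidLine.curvSq]
    ring
  have hdet : Real.sqrt (C.g t y).det = Real.exp (3 * C.σ t y) * Real.sqrt (C.q y).det := by
    rw [g, Matrix.det_smul, Fintype.card_fin, Real.sqrt_mul (by positivity),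
      show Real.exp (2 * C.σ t y) ^ 3 = Real.exp (3 * C.σ t y) ^ 2 by
        rw [← Real.exp_nat_mul, ← Real.exp_nat_mul]; congr 1; push_cast; ring,
      Real.sqrt_sq (Real.exp_pos _).le]
  have hiff : (∀ a b c d : Idx, riemann I γ a b c d t y = 0)
      ↔ FluidLine.curvSq c (fun t => C.σ t y) (fun t => μ t y) k t = 0 := by
    rw [← Real.sqrt_eq_zero (FluidLine.curvSq_nonneg hc t), ← hR]
    constructor
    · intro h0
      have : curv I γ t y = fun _ _ _ _ => 0 := by
        ext a b c d
        exact h0 a b c d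
      rw [this]
      simp [norm4]
    · exact fun h0 => hp.riemann_eq_zero h0
  rw [FluidLine.entropy, hdet, hW]
  change (if _ then 1 else _ / norm4 _ (curv I γ t y)) * _ = _
  rw [hR]
  congr 1
  exact if_congr hiff rfl rfl

lemma IsFluid.fluidLine (h : C.IsFluid γ μ P) {y : E3} (hy : y ∈ U) {k κ : ℝ → ℝ}
    (hP : ∀ t ∈ I, P t y = (k t - 1) * μ t y) (hs : ∀ t ∈ I, 0 ≤ C.s t y)
    (hk : ∀ t ∈ I, k t ∈ Set.Icc (0 : ℝ) (4 / 3))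
    (hk' : ∀ t ∈ I, HasDerivWithinAt k (-(3 * C.s t y * κ t)) I t)
    (hκ : ∀ t ∈ I, 0 ≤ κ t)
    (hκ' : ∀ t ∈ I, κ t * (3 * (4 - 3 * k t)) ≤ k t * (9 * k t ^ 2 - 12 * k t + 8)) :
    FluidLine I (fun t => C.σ t y) (fun t => C.s t y) (fun t => μ t y) k κ where
  ordConnected := C.ordConnected
  hasDeriv_σ t ht := C.hasDerivWithinAt_σ ht hy
  s_nonneg := hs
  k_mem := hk
  hasDeriv_μ t ht := (h.hasDerivWithinAt_μ ht hy).congr_deriv (by rw [hP t ht]; ring)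
  hasDeriv_k := hk'
  κ_nonneg := hκ
  κ_le := hκ'

end CoordMetric

/-! ### Charts of the slice -/

section Charts

/-- Serves twice: with L the derivative of an inverse chart, and with L the identity of the tangent
space. -/
lemma posDef_of_bilin {V : Type*} [AddCommGroup V] [Module ℝ V] [TopologicalSpace V]
    (B : V →L[ℝ] V →L[ℝ] ℝ)
    (hs : ∀ v w, B v w = B w v) (hp : ∀ v, v ≠ 0 → 0 < B v v) (L : E3 →L[ℝ] V)
    (hL : Function.Injective L) :
    (Matrix.of fun i j => B (L (EuclideanSpace.single i 1)) (L (EuclideanSpace.single j 1)) :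
      Matrix (Fin 3) (Fin 3) ℝ).PosDef := by
  refine Matrix.PosDef.of_dotProduct_mulVec_pos ?_ fun x hx => ?_
  · ext i j
    simp [hs]
  · have hx' : (WithLp.toLp 2 x : E3) ≠ 0 := fun h => hx (by
      ext i
      exact congrFun (congrArg WithLp.ofLp h) i)
    have hsum : (WithLp.toLp 2 x : E3) = ∑ i, x i • EuclideanSpace.single i (1 : ℝ) := by
      ext j
      simp [Finset.sum_apply, Pi.single_apply]
    have h1 := hp (L (WithLp.toLp 2 x)) fun h => hx' (hL (by rw [h, map_zero]))
    rw [hsum] at h1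
    simp only [map_sum, map_smul, sum_apply, smul_apply,
      smul_eq_mul] at h1
    simp only [dotProduct, Matrix.mulVec, Matrix.of_apply, star_trivial]
    refine lt_of_lt_of_eq h1 ?_
    simp only [Finset.mul_sum]
    rw [Finset.sum_comm]
    exact Finset.sum_congr rfl fun i _ => Finset.sum_congr rfl fun j _ => by ring

variable {M : Type*} [TopologicalSpace M] [ChartedSpace E3 M]
  {e : OpenPartialHomeomorph M E3}

lemma chart_mdifferentiable (he : e ∈ IsManifold.maximalAtlas (𝓡 3) ∞ M) :
    e.MDifferentiable (𝓡 3) (𝓡 3) :=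
  ⟨(contMDiffOn_of_mem_maximalAtlas he).mdifferentiableOn (by simp),
    (contMDiffOn_symm_of_mem_maximalAtlas he).mdifferentiableOn (by simp)⟩

lemma contDiffOn_comp_symm (he : e ∈ IsManifold.maximalAtlas (𝓡 3) ∞ M) {I : Set ℝ}
    {f : ℝ → M → ℝ}
    (hf : ContMDiffOn (𝓘(ℝ, ℝ).prod (𝓡 3)) 𝓘(ℝ, ℝ) ∞ (fun p : ℝ × M => f p.1 p.2)
      (I ×ˢ Set.univ)) :
    ContDiffOn ℝ ∞ (fun p : ℝ × E3 => f p.1 (e.symm p.2)) (I ×ˢ e.target) := by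
  have h1 : ContMDiffOn (𝓘(ℝ, ℝ).prod (𝓡 3)) (𝓘(ℝ, ℝ).prod (𝓡 3)) ∞
      (fun p : ℝ × E3 => (p.1, e.symm p.2)) (I ×ˢ e.target) :=
    contMDiffOn_fst.prodMk ((contMDiffOn_symm_of_mem_maximalAtlas he).comp contMDiffOn_snd
      fun p hp => hp.2)
  have h2 := hf.comp h1 fun p hp => ⟨hp.1, Set.mem_univ _⟩
  rw [← contMDiffOn_iff_contDiffOn, modelWithCornersSelf_prod, ← chartedSpaceSelf_prod]
  exact h2

lemma mfderiv_symm_injective (he : e ∈ IsManifold.maximalAtlas (𝓡 3) ∞ M) {y : E3}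
    (hy : y ∈ e.target) : Function.Injective (mfderiv (𝓡 3) (𝓡 3) e.symm y) := by
  have h := (chart_mdifferentiable he).comp_symm_deriv hy
  intro v w hvw
  have key : ∀ v, mfderiv (𝓡 3) (𝓡 3) e (e.symm y) (mfderiv (𝓡 3) (𝓡 3) e.symm y v) = v :=
    fun v => congrArg (fun L : TangentSpace (𝓡 3) y →L[ℝ] TangentSpace (𝓡 3) y => L v) h
  rw [← key v, ← key w, hvw]

variable [IsManifold (𝓡 3) ∞ M]

/-- The coordinate field is the tangent map of the inverse chart applied to a constant vector field.
-/
lemma contMDiffOn_coordVec (he : e ∈ IsManifold.maximalAtlas (𝓡 3) ∞ M) (i : Fin 3) :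
    ContMDiffOn (𝓡 3) ((𝓡 3).prod (𝓡 3)) ∞
      (fun y => (Bundle.TotalSpace.mk' E3 (e.symm y) (coordVec e i y) : TangentBundle (𝓡 3) M))
      e.target := by
  have h1 : ContMDiffOn (𝓡 3).tangent (𝓡 3).tangent ∞ (tangentMapWithin (𝓡 3) (𝓡 3) e.symm e.target)
      (Bundle.TotalSpace.proj ⁻¹' e.target) :=
    (contMDiffOn_symm_of_mem_maximalAtlas he).contMDiffOn_tangentMapWithin (by simp)
      e.open_target.uniqueMDiffOn
  have h2 : ContMDiff (𝓡 3) (𝓡 3).tangent ∞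
      (fun y : E3 => (⟨y, EuclideanSpace.single i (1 : ℝ)⟩ : TangentBundle (𝓡 3) E3)) := by
    exact contMDiff_vectorSpace_iff_contDiff.2 contDiff_const
  have h3 := h1.comp (h2.contMDiffOn (s := e.target)) (fun y hy => hy)
  refine h3.congr fun y hy => ?_
  simp only [Function.comp, tangentMapWithin, mfderivWithin_of_isOpen e.open_target hy]
  rfl

lemma contDiffOn_inner_coordVec (he : e ∈ IsManifold.maximalAtlas (𝓡 3) ∞ M)
    (gbar : Bundle.ContMDiffRiemannianMetric (𝓡 3) ∞ (EuclideanSpace ℝ (Fin 3))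
      (fun x : M => TangentSpace (𝓡 3) x)) (i j : Fin 3) :
    ContDiffOn ℝ ∞ (fun y => gbar.inner (e.symm y) (coordVec e i y) (coordVec e j y)) e.target := by
  have h1 := gbar.contMDiff.comp_contMDiffOn (contMDiffOn_symm_of_mem_maximalAtlas he)
  have h2 := ContMDiffOn.clm_bundle_apply₂ (F₁ := E3) (F₂ := E3) (F₃ := ℝ)
    (E₃ := fun _ : M => ℝ) (b := fun y => e.symm y) h1
    (contMDiffOn_coordVec he i) (contMDiffOn_coordVec he j)
  rw [← contMDiffOn_iff_contDiffOn]
  intro y hy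
  have h3 := h2 y hy
  simp only [Bundle.contMDiffWithinAt_totalSpace] at h3
  exact h3.2

end Charts

/-! ### Local constancy of the mean curvature -/

namespace CoordMetric

variable {I : Set ℝ} {U : Set E3} {C : CoordMetric I U}

lemma differentiableAt_of_repr {f : ℝ → E3 → ℝ} {a : smoothFun (I ×ˢ U)} (C : CoordMetric I U)
    (h : Repr f a) {t : ℝ} {y : E3} (ht : t ∈ I) (hy : y ∈ U) : DifferentiableAt ℝ (f t) y := by
  have hF := (smoothFun.differentiableWithinAt a (p := (t, y)) ⟨ht, hy⟩).hasFDerivWithinAt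
  have h1 : HasFDerivWithinAt (fun z : E3 => (t, z)) (ContinuousLinearMap.inr ℝ ℝ E3) U y :=
    (hasFDerivAt_prodMk_right t y).hasFDerivWithinAt
  have h2 := HasFDerivWithinAt.comp (t := I ×ˢ U) y hF h1 (fun z hz => Set.mk_mem_prod ht hz)
  have hext : ∀ z ∈ U, f t z = extendZero a.1 (t, z) := fun z hz =>
    ((extendZero_apply a.1 ⟨(t, z), ht, hz⟩).trans (h _)).symm
  exact ((h2.congr hext (hext y hy)).hasFDerivAt (C.isOpen.mem_nhds hy)).differentiableAt

/-- The function `σ_t / n` is locally constant on the slices of a perfect fluid. -/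
lemma IsFluid.eventually_θ {γ : ℝ → E3 → Matrix Idx Idx ℝ} {μ P : ℝ → E3 → ℝ}
    (h : C.IsFluid γ μ P) {t : ℝ} (ht : t ∈ I) {y : E3} (hy : y ∈ U) :
    ∀ᶠ z in nhds y, C.s t z / C.n t z = C.s t y / C.n t y := by
  obtain ⟨r, hr, hball⟩ := Metric.isOpen_iff.1 C.isOpen y hy
  have hrep : Repr (fun t y => C.s t y / C.n t y) C.data.θ := C.ev_θ
  have hdiff : ∀ z ∈ U, DifferentiableAt ℝ (fun z => C.s t z / C.n t z) z := fun z hz =>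
    differentiableAt_of_repr (f := fun t y => C.s t y / C.n t y) C hrep ht hz
  have hzero : ∀ z ∈ U, fderiv ℝ (fun z => C.s t z / C.n t z) z = 0 := by
    intro z hz
    apply ContinuousLinearMap.coe_injective
    refine (EuclideanSpace.basisFun (Fin 3) ℝ).toBasis.ext fun j => ?_
    have h1 := hrep.pd C.ordConnected C.nontrivial C.isOpen (Sum.inr j) ⟨(t, z), ht, hz⟩
    have h2 : coordDeriv C.ordConnected C.nontrivial C.isOpen (Sum.inr j) C.data.θ = 0 :=
      h.deriv_θ j
    rw [h2, map_zero] at h1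
    have h3 : fderiv ℝ (fun z => C.s t z / C.n t z) z (EuclideanSpace.single j 1) = 0 := h1.symm
    simpa using h3
  filter_upwards [Metric.ball_mem_nhds y hr] with z hz
  refine (convex_ball y r).is_const_of_fderivWithin_eq_zero (𝕜 := ℝ)
    (f := fun z => C.s t z / C.n t z)
    (fun w hw => (hdiff w (hball hw)).differentiableWithinAt) (fun w hw => ?_) hz
    (Metric.mem_ball_self hr)
  rw [fderivWithin_of_isOpen Metric.isOpen_ball hw, hzero w (hball hw)]

end CoordMetric

/-! ### From charts to the spacetime -/

section Spacetime

variable {M : Type*} [TopologicalSpace M] [ChartedSpace E3 M] [IsManifold (𝓡 3) ∞ M]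

/-- The data of a spacetime `-N² dt² + e^{2σ} ḡ`. -/
structure ConformalSpacetime (M : Type*) [TopologicalSpace M] [ChartedSpace E3 M]
    [IsManifold (𝓡 3) ∞ M] where
  I : Set ℝ
  ordConnected : I.OrdConnected
  nontrivial : I.Nontrivial
  N : ℝ → M → ℝ
  N_smooth : ContMDiffOn (𝓘(ℝ, ℝ).prod (𝓡 3)) 𝓘(ℝ, ℝ) ∞ (fun p : ℝ × M => N p.1 p.2)
    (I ×ˢ Set.univ)
  N_pos : ∀ t ∈ I, ∀ x : M, 0 < N t x
  σ : ℝ → M → ℝ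
  σ_smooth : ContMDiffOn (𝓘(ℝ, ℝ).prod (𝓡 3)) 𝓘(ℝ, ℝ) ∞ (fun p : ℝ × M => σ p.1 p.2)
    (I ×ˢ Set.univ)
  gbar : Bundle.ContMDiffRiemannianMetric (𝓡 3) ∞ (EuclideanSpace ℝ (Fin 3))
    (fun x : M => TangentSpace (𝓡 3) x)
  g : BilinField M
  g_eq : ∀ t ∈ I, ∀ (x : M) (v w : TangentSpace (𝓡 3) x),
    g t x v w = Real.exp (2 * σ t x) * gbar.inner x v w

namespace ConformalSpacetime

variable (Y : ConformalSpacetime M)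

/-- The coefficients of the metric in a chart. -/
def coord (e : OpenPartialHomeomorph M E3) (he : e ∈ IsManifold.maximalAtlas (𝓡 3) ∞ M) :
    CoordMetric Y.I e.target where
  ordConnected := Y.ordConnected
  nontrivial := Y.nontrivial
  isOpen := e.open_target
  n t y := Y.N t (e.symm y)
  σ t y := Y.σ t (e.symm y)
  q y := Matrix.of fun i j => Y.gbar.inner (e.symm y) (coordVec e i y) (coordVec e j y)
  n_smooth := contDiffOn_comp_symm he Y.N_smooth
  σ_smooth := contDiffOn_comp_symm he Y.σ_smooth
  q_smooth i j := contDiffOn_inner_coordVec he Y.gbar i j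
  n_pos t ht _ _ := Y.N_pos t ht _
  q_posDef y hy := posDef_of_bilin (Y.gbar.inner (e.symm y)) (Y.gbar.symm _) (Y.gbar.pos _)
    (mfderiv (𝓡 3) (𝓡 3) e.symm y) (mfderiv_symm_injective he hy)

variable {e : OpenPartialHomeomorph M E3} (he : e ∈ IsManifold.maximalAtlas (𝓡 3) ∞ M)

lemma spaceComp_eq {t : ℝ} (ht : t ∈ Y.I) (y : E3) :
    spaceComp Y.g e t y = (Y.coord e he).g t y := by
  ext i j
  exact Y.g_eq t ht _ _ _

lemma lorentz_eq {t : ℝ} (ht : t ∈ Y.I) (y : E3) :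
    lorentz Y.N Y.g e t y = (Y.coord e he).γ t y := by
  rw [lorentz, Y.spaceComp_eq he ht]
  rfl

lemma riemMetric_eq {t : ℝ} (ht : t ∈ Y.I) (y : E3) :
    riemMetric Y.N Y.g e t y = blockRiem ((Y.coord e he).n t y) ((Y.coord e he).g t y) := by
  rw [riemMetric, Y.spaceComp_eq he ht]
  rfl

lemma isFluid {μ k : ℝ → M → ℝ} (h : IsPerfectFluid Y.I Y.N Y.g μ k) :
    (Y.coord e he).IsFluid (lorentz Y.N Y.g e) (fun t y => μ t (e.symm y))
      (fun t y => (k t (e.symm y) - 1) * μ t (e.symm y)) where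
  metric t ht y _ := Y.lorentz_eq he ht y
  einstein t ht y hy a b := by
    rw [h.2 e he t ht y hy, fluidTensor, Y.spaceComp_eq he ht]
    rfl

lemma hasDerivWithinAt_σ {t : ℝ} (ht : t ∈ Y.I) (x : M) :
    HasDerivWithinAt (fun s => Y.σ s x) (derivWithin (fun s => Y.σ s x) Y.I t) Y.I t := by
  have he := IsManifold.chart_mem_maximalAtlas (I := 𝓡 3) (n := ∞) x
  have h := (Y.coord _ he).hasDerivWithinAt_σ ht (mem_chart_target E3 x)
  simp only [coord, CoordMetric.s, (chartAt E3 x).left_inv (mem_chart_source E3 x)] at h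
  exact h

lemma secondForm_eq {t : ℝ} (ht : t ∈ Y.I) (x : M) (v w : TangentSpace (𝓡 3) x) :
    secondForm Y.I Y.N Y.g t x v w
      = -(derivWithin (fun s => Y.σ s x) Y.I t / Y.N t x) * Y.g t x v w := by
  have h1 := (((Y.hasDerivWithinAt_σ ht x).const_mul 2).exp.mul_const
    (Y.gbar.inner x v w)).congr_of_mem (fun s hs => Y.g_eq s hs x v w) ht
  rw [secondForm, h1.derivWithin (interval_uniqueDiffOn Y.ordConnected Y.nontrivial t ht),
    Y.g_eq t ht]
  have := (Y.N_pos t ht x).ne'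
  field_simp

lemma meanCurv_eq {t : ℝ} (ht : t ∈ Y.I) (x : M) : meanCurv Y.I Y.N Y.g t x
    = -3 * (derivWithin (fun s => Y.σ s x) Y.I t / Y.N t x) := by
  have hpos : (Matrix.of fun k l => Y.g t x (tangentBasis x k) (tangentBasis x l) :
      Matrix (Fin 3) (Fin 3) ℝ).PosDef :=
    posDef_of_bilin (Y.g t x) (fun v w => by rw [Y.g_eq t ht, Y.g_eq t ht, Y.gbar.symm])
      (fun v hv => by
        rw [Y.g_eq t ht]
        exact mul_pos (Real.exp_pos _) (Y.gbar.pos x v hv))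
      (ContinuousLinearMap.id ℝ (TangentSpace (𝓡 3) x)) Function.injective_id
  have h := trace_inv_mul hpos
  rw [Fintype.card_fin] at h
  rw [meanCurv]
  simp only [Y.secondForm_eq ht, mul_left_comm _ (-(_ / _) : ℝ), ← Finset.mul_sum]
  simp only [Matrix.of_apply] at h
  rw [h]
  push_cast
  ring

lemma isUmbilic : IsUmbilic Y.I Y.N Y.g := by
  intro t ht x v w
  rw [Y.secondForm_eq ht, Y.meanCurv_eq ht]
  ring

/-- By the momentum constraint in a chart, H = -3σ_t / N is locally constant, and M is connected. -/
lemma meanCurv_const [ConnectedSpace M] {μ k : ℝ → M → ℝ}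
    (h : IsPerfectFluid Y.I Y.N Y.g μ k) {t : ℝ} (ht : t ∈ Y.I) (x x' : M) :
    meanCurv Y.I Y.N Y.g t x = meanCurv Y.I Y.N Y.g t x' := by
  refine IsLocallyConstant.apply_eq_of_isPreconnected (f := fun x => meanCurv Y.I Y.N Y.g t x)
    ((IsLocallyConstant.iff_eventually_eq _).2 fun x => ?_) isPreconnected_univ
    (Set.mem_univ x) (Set.mem_univ x')
  have he := IsManifold.chart_mem_maximalAtlas (I := 𝓡 3) (n := ∞) x
  have hx := mem_chart_source E3 x
  have h1 := (Y.isFluid he h).eventually_θ ht (mem_chart_target E3 x)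
  filter_upwards [((chartAt E3 x).continuousAt hx).eventually h1,
    (chartAt E3 x).open_source.mem_nhds hx] with z hz hz'
  simp only [coord, CoordMetric.s, (chartAt E3 x).left_inv hx, (chartAt E3 x).left_inv hz'] at hz
  rw [Y.meanCurv_eq ht, Y.meanCurv_eq ht, hz]

lemma isPurelyElectric {μ k : ℝ → M → ℝ} (h : IsPerfectFluid Y.I Y.N Y.g μ k) :
    IsPurelyElectric Y.I Y.N Y.g := by
  intro e he t ht y hy i j l
  have hp := ((Y.isFluid he h).point ⟨(t, y), ht, hy⟩).weyl_tsss i j l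
  change weylOf (lorentz Y.N Y.g e t y) (CoordMetric.curv Y.I (lorentz Y.N Y.g e) t y) _ _ _ _ = 0
  rw [Y.lorentz_eq he ht]
  exact hp

lemma isExpanding (hσ : ∀ t ∈ Y.I, ∀ x, 0 ≤ derivWithin (fun s => Y.σ s x) Y.I t) :
    IsExpanding Y.I Y.N Y.g (fun _ _ => 1 / 3) := by
  intro t ht x
  refine ⟨by norm_num, fun v => ?_⟩
  rw [Y.secondForm_eq ht, Y.meanCurv_eq ht]
  have h1 : 0 ≤ derivWithin (fun s => Y.σ s x) Y.I t / Y.N t x :=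
    div_nonneg (hσ t ht x) (Y.N_pos t ht x).le
  have h2 : 0 ≤ Y.g t x v v := by
    rw [Y.g_eq t ht]
    rcases eq_or_ne v 0 with rfl | hv
    · simp
    · exact (mul_pos (Real.exp_pos _) (Y.gbar.pos x v hv)).le
  have h3 := mul_nonneg h1 h2
  constructor <;> linarith

lemma exists_hasDeriv_weylEntropy (he : e ∈ IsManifold.maximalAtlas (𝓡 3) ∞ M)
    (hσ : ∀ t ∈ Y.I, ∀ x, 0 ≤ derivWithin (fun s => Y.σ s x) Y.I t)
    {μ k : ℝ → M → ℝ} (h : IsPerfectFluid Y.I Y.N Y.g μ k) (hk : FluidEvolution Y.I Y.N Y.g k)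
    {y : E3} (hy : y ∈ e.target) : ∃ F' : ℝ → ℝ, ∀ t ∈ Y.I,
      HasDerivWithinAt (fun s => weylEntropy Y.I Y.N Y.g e s y) (F' t) Y.I t ∧ 0 ≤ F' t := by
  obtain ⟨k', hk'⟩ := hk
  have hF := Y.isFluid he h
  obtain ⟨c, d, hc, hd, hS⟩ := hF.exists_entropy hy (k := fun t => k t (e.symm y))
    (fun t _ => rfl)
  have hline := hF.fluidLine hy (k := fun t => k t (e.symm y)) (κ := fun t => k' t (e.symm y))
    (fun t _ => rfl) (fun t ht => hσ t ht _) (fun t ht => h.1 t ht _)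
    -- D_T k = k' H becomes ∂_t k = -3σ_t k', because N H = -3σ_t.
    (fun t ht => by
      refine (hk' t ht (e.symm y)).1.congr_deriv ?_
      have := (Y.N_pos t ht (e.symm y)).ne'
      rw [Y.meanCurv_eq ht]
      simp only [CoordMetric.s, coord]
      field_simp)
    (fun t ht => (hk' t ht _).2.1) (fun t ht => (hk' t ht _).2.2)
  obtain ⟨F', hF'⟩ := hline.exists_hasDeriv_entropy hc hd
  refine ⟨F', fun t ht => ⟨(hF' t ht).1.congr_of_mem (fun s hs => ?_) ht, (hF' t ht).2⟩⟩
  rw [← hS s hs, weylEntropy, weylDensity, sqrtDet, Y.riemMetric_eq he hs, Y.spaceComp_eq he hs]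

end ConformalSpacetime

lemma sCrit_third (k : ℝ) : sCrit k (1 / 3) = 0 := by
  simp [sCrit]

end Spacetime

end WeylEntropy

end

open WeylEntropy in
theorem proposition7p1
    {M : Type*} [TopologicalSpace M] [ChartedSpace (EuclideanSpace ℝ (Fin 3)) M]
    [IsManifold (𝓡 3) ∞ M] [ConnectedSpace M]
    (I : Set ℝ) (hI : I.OrdConnected) (hI' : I.Nontrivial)
    (N : ℝ → M → ℝ)
    (hN : ContMDiffOn (𝓘(ℝ, ℝ).prod (𝓡 3)) 𝓘(ℝ, ℝ) ∞ (fun p : ℝ × M => N p.1 p.2)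
      (I ×ˢ Set.univ))
    (hN_pos : ∀ t ∈ I, ∀ x : M, 0 < N t x)
    (σ : ℝ → M → ℝ)
    (hσ : ContMDiffOn (𝓘(ℝ, ℝ).prod (𝓡 3)) 𝓘(ℝ, ℝ) ∞ (fun p : ℝ × M => σ p.1 p.2)
      (I ×ˢ Set.univ))
    (gbar : Bundle.ContMDiffRiemannianMetric (𝓡 3) ∞ (EuclideanSpace ℝ (Fin 3))
      (fun x : M => TangentSpace (𝓡 3) x))
    (g : BilinField M)
    (hg : ∀ t ∈ I, ∀ (x : M) (v w : TangentSpace (𝓡 3) x),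
      g t x v w = Real.exp (2 * σ t x) * gbar.inner x v w)
    (hσ_mono : ∀ t ∈ I, ∀ x : M, 0 ≤ derivWithin (fun s => σ s x) I t)
    (μ k : ℝ → M → ℝ)
    (hfluid : IsPerfectFluid I N g μ k)
    (hk : FluidEvolution I N g k) :
    IsUmbilic I N g ∧
    (∀ t ∈ I, ∀ x x' : M, meanCurv I N g t x = meanCurv I N g t x') ∧
    IsPurelyElectric I N g ∧
    IsExpanding I N g (fun _ _ => 1 / 3) ∧
    (∀ t ∈ I, ∀ x : M, sCrit (k t x) (1 / 3) = 0) ∧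
    ∀ e ∈ IsManifold.maximalAtlas (𝓡 3) ∞ M, ∀ y ∈ e.target,
      (∀ t ∈ I, fluidEntropy I N g k (fun _ _ => 1 / 3) e t y = weylEntropy I N g e t y) ∧
      (∀ t ∈ I, DifferentiableWithinAt ℝ (fun s => weylEntropy I N g e s y) I t ∧
        0 ≤ (N t (e.symm y))⁻¹ * derivWithin (fun s => weylEntropy I N g e s y) I t) ∧
      MonotoneOn (fun t => weylEntropy I N g e t y) I := by
  let Y : ConformalSpacetime M := ⟨I, hI, hI', N, hN, hN_pos, σ, hσ, gbar, g, hg⟩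
  refine ⟨Y.isUmbilic, fun t ht x x' => Y.meanCurv_const hfluid ht x x',
    Y.isPurelyElectric hfluid, Y.isExpanding hσ_mono, fun t _ x => sCrit_third _,
    fun e he y hy => ?_⟩
  obtain ⟨F', hF⟩ := Y.exists_hasDeriv_weylEntropy he hσ_mono hfluid hk hy
  refine ⟨fun t _ => by rw [fluidEntropy, sCrit_third, zero_mul, add_zero], fun t ht => ?_,
    monotoneOn_of_hasDerivWithinAt hI (fun t ht => (hF t ht).1) (fun t ht => (hF t ht).2)⟩
  refine ⟨(hF t ht).1.differentiableWithinAt, ?_⟩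
  have hd := (hF t ht).1.derivWithin (interval_uniqueDiffOn hI hI' t ht)
  rw [hd]
  exact mul_nonneg (inv_nonneg.2 (hN_pos t ht _).le) (hF t ht).2
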